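/- Let $\mathbb{T}=\mathbb{R}/2\pi\mathbb{Z}$, and let $L^2=L^2(\mathbb{T};\mathbb{C})$ carry the normalized measure $dy/2\pi$, with Fourier coefficients $f_j=\frac1{2\pi}\int_{\mathbb{T}}e^{-ijy}f(y)\,dy$. Write $\Pi_0f=f_0$ and $\Pi_{\neq}=\mathrm{Id}-\Pi_0$. Let $\|U\|_{C^2}=\sup|U|+\sup|U'|+\sup|U''|$, and let $\partial_y^{-1}$ be the Fourier multiplier with symbol $1/(ij)$ for $j\ne0$ and $0$ for $j=0$. For a real-valued $U\in C^2(\mathbb{T})$ with $\int_{\mathbb{T}}U\,dy=0$ and for $\nu,\varepsilon>0$ consider the unbounded operator on $L^2$ with domain $H^2(\mathbb{T})$ $$\mathcal{L}_{\nu,\varepsilon}=\mathcal{M}_{\nu,\varepsilon}-i\varepsilon\mathcal{R}_\varepsilon,\qquad \mathcal{M}_{\nu,\varepsilon}=\nu(\partial_{yy}-\varepsilon^2)-\frac{i}{\varepsilon}U''\,\Pi_0,\qquad \mathcal{R}_\varepsilon=U+U''(-\partial_{yy}+\varepsilon^2)^{-1}\Pi_{\neq}.$$ **Theorem.** For every $K$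 there exist $\delta_0\in(0,1)$ and $C>1$ such that, for every real-valued $U\in C^2(\mathbb{T})$ with zero mean and $\|U\|_{C^2}\le K$, and all $\nu,\varepsilon>0$ with $\varepsilon\le\delta_0\nu$, there is a family $(\lambda^{(j)})_{j\in\mathbb{Z}}$ of complex numbers (depending on $U,\nu,\varepsilon$) with the following properties. 1. $\lambda^{(0)}$ is an algebraically simple eigenvalue of $\mathcal{L}_{\nu,\varepsilon}$, and $$\Big|\lambda^{(0)}-\frac{\varepsilon^2}{\nu}\big(\|\partial_y^{-1}U\|_{L^2}^2-\nu^2\big)\Big|\le C\,\frac{\varepsilon^2}{\nu}\,\varepsilon(\nu+\nu^{-1}).$$ 2. There is an eigenvector $V\in H^2(\mathbb{T})$, $V\neq0$, with $\mathcal{L}_{\nu,\varepsilon}V=\lambda^{(0)}V$ and $$\|V-(U-i\nu\varepsilon)\|_{L^2}\le C\,\frac{\varepsilon}{\nu}\,(1+\varepsilon\nu);$$ in particular the right-hand side is at most $2C\varepsilon/\nu$ whenever $\varepsilon\nu\le1$. 3. $\sigma_{L^2}(\mathcal{L}_{\nu,\varepsilon})=\{\lambda^{(j)}\}_{j\in\mathbb{Z}}$,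 where each $z\in\mathbb{C}$ occurs among the $\lambda^{(j)}$ exactly as many times as its algebraic multiplicity as an eigenvalue of $\mathcal{L}_{\nu,\varepsilon}$, and $$\big|\lambda^{(j)}+\nu(j^2+\varepsilon^2)\big|\le\frac{\nu}{2}\qquad\text{for all }j\in\mathbb{Z}.$$ -/

import Mathlib

open MeasureTheory Real
open scoped ENNReal

noncomputable section

namespace OrrSommerfeld

instance fact_two_pi_pos : Fact (0 < 2 * π) := ⟨Real.two_pi_pos⟩

/-- The torus `𝕋 = ℝ / 2πℤ`. -/
abbrev Torus : Type := AddCircle (2 * π)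

/-- `L²(𝕋)` with complex values, for the normalized measure `dy / 2π`, so that the exponentials
`e^{ijy}` are orthonormal and the average of `f` is `⟨1, f⟩`. -/
abbrev L2T : Type := Lp ℂ 2 (AddCircle.haarAddCircle : Measure Torus)

/-- The `j`-th Fourier coefficient `f_j = (1 / 2π) ∫ e^{-ijy} f(y) dy`. -/
def coeff (f : L2T) (j : ℤ) : ℂ := fourierCoeff (f : Torus → ℂ) j

/-! ### Fourier multipliers -/

theorem coeff_eq_repr (f : L2T) (j : ℤ) : coeff f j = (fourierBasis.repr f : ℤ → ℂ) j :=
  (fourierBasis_repr f j).symm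

theorem coeff_add (f g : L2T) (j : ℤ) : coeff (f + g) j = coeff f j + coeff g j := by
  simp [coeff_eq_repr]

theorem coeff_smul (c : ℂ) (f : L2T) (j : ℤ) : coeff (c • f) j = c * coeff f j := by
  simp [coeff_eq_repr]

theorem coeff_zero (j : ℤ) : coeff 0 j = 0 := by
  simp [coeff_eq_repr]

theorem coeff_injective {f g : L2T} (h : ∀ j, coeff f j = coeff g j) : f = g := by
  apply fourierBasis.repr.injective
  ext j
  simpa [coeff_eq_repr] using h j

/-- The `L²` function with a given square-summable sequence of Fourier coefficients. -/
def ofCoeff (a : ℤ → ℂ) (ha : Memℓp a 2) : L2T :=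
  fourierBasis.repr.symm (⟨a, ha⟩ : lp (fun _ : ℤ => ℂ) 2)

theorem coeff_ofCoeff (a : ℤ → ℂ) (ha : Memℓp a 2) (j : ℤ) : coeff (ofCoeff a ha) j = a j := by
  simp [coeff_eq_repr, ofCoeff]

theorem memℓp_mul_coeff {m : ℤ → ℂ} {B : ℝ} (hm : ∀ j, ‖m j‖ ≤ B) (f : L2T) :
    Memℓp (fun j => m j * coeff f j) 2 := by
  have h1 : Memℓp (fun j => (B : ℂ) * coeff f j) 2 := by
    have h := (lp.memℓp (fourierBasis.repr f)).const_smul (B : ℂ)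
    have e : (fun j => (B : ℂ) * coeff f j) = (B : ℂ) • (fourierBasis.repr f : ℤ → ℂ) :=
      funext fun j => by simp [coeff_eq_repr]
    rw [e]
    exact h
  have hB : 0 ≤ B := (norm_nonneg _).trans (hm 0)
  refine h1.mono' ?_
  intro j
  rw [norm_mul, norm_mul, Complex.norm_real, Real.norm_of_nonneg hB]
  exact mul_le_mul_of_nonneg_right (hm j) (norm_nonneg _)

/-- The bounded Fourier multiplier `f ↦ ∑ j, m j * f_j * e^{ijy}` with bounded symbol `m`. -/
def multiplier (m : ℤ → ℂ) (hm : ∃ B : ℝ, ∀ j, ‖m j‖ ≤ B) : L2T →L[ℂ] L2T :=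
  LinearMap.mkContinuousOfExistsBound
    { toFun := fun f => ofCoeff (fun j => m j * coeff f j) (memℓp_mul_coeff hm.choose_spec f)
      map_add' := fun f g => coeff_injective fun j => by
        simp only [coeff_add, coeff_ofCoeff, mul_add]
      map_smul' := fun c f => coeff_injective fun j => by
        simp only [coeff_smul, coeff_ofCoeff, RingHom.id_apply]; ring }
    (by
      obtain ⟨B, hB⟩ := hm
      refine ⟨B, fun f => ?_⟩
      have hB0 : 0 ≤ B := (norm_nonneg _).trans (hB 0)
      have h1 : ‖(B : ℂ) • fourierBasis.repr f‖ = B * ‖f‖ := by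
        rw [norm_smul, Complex.norm_real, Real.norm_of_nonneg hB0,
          LinearIsometryEquiv.norm_map]
      rw [← h1]
      simp only [LinearMap.coe_mk, AddHom.coe_mk, ofCoeff, LinearIsometryEquiv.norm_map]
      refine lp.norm_mono (by norm_num) fun j => ?_
      simp only [lp.coeFn_smul, Pi.smul_apply, smul_eq_mul, norm_mul, Complex.norm_real,
        Real.norm_of_nonneg hB0, ← coeff_eq_repr]
      exact mul_le_mul_of_nonneg_right (hB j) (norm_nonneg _))

theorem coeff_multiplier (m : ℤ → ℂ) (hm : ∃ B : ℝ, ∀ j, ‖m j‖ ≤ B) (f : L2T) (j : ℤ) :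
    coeff (multiplier m hm f) j = m j * coeff f j :=
  coeff_ofCoeff _ _ j

/-- The orthogonal projection `Π₀` onto the constants, `f ↦ f_0`. -/
def projZero : L2T →L[ℂ] L2T :=
  multiplier (fun j => if j = 0 then 1 else 0) ⟨1, fun j => by split_ifs <;> simp⟩

/-- `Π_≠ = Id - Π₀`. -/
def projNonzero : L2T →L[ℂ] L2T := ContinuousLinearMap.id ℂ L2T - projZero

theorem coeff_projNonzero (f : L2T) (j : ℤ) :
    coeff (projNonzero f) j = if j = 0 then 0 else coeff f j := by
  have h : projNonzero f = f + (-1 : ℂ) • projZero f := by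
    simp [projNonzero, sub_eq_add_neg]
  rw [h, coeff_add, coeff_smul, projZero, coeff_multiplier]
  split_ifs <;> simp

/-- `H²(𝕋)`: the `f ∈ L²(𝕋)` whose second derivative, with Fourier coefficients `(ij)² f_j`,
is in `L²(𝕋)`. -/
def H2 : Submodule ℂ L2T where
  carrier := {f | Memℓp (fun j : ℤ => (Complex.I * j) ^ 2 * coeff f j) 2}
  zero_mem' := by
    have e : (fun j : ℤ => (Complex.I * j) ^ 2 * coeff 0 j) = (0 : ℤ → ℂ) :=
      funext fun j => by simp [coeff_zero]
    change Memℓp (fun j : ℤ => (Complex.I * j) ^ 2 * coeff 0 j) 2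
    rw [e]
    exact zero_memℓp
  add_mem' := fun {f g} hf hg => by
    have h := hf.add hg
    simp only [Set.mem_ofPred_eq, coeff_add, mul_add]
    exact h
  smul_mem' := fun c f hf => by
    have h := hf.const_smul c
    simp only [Set.mem_ofPred_eq, coeff_smul]
    convert h using 1
    ext j
    simp only [Pi.smul_apply, smul_eq_mul]
    ring

theorem mem_H2 {f : L2T} : f ∈ H2 ↔ Memℓp (fun j : ℤ => (Complex.I * j) ^ 2 * coeff f j) 2 :=
  Iff.rfl

/-- `∂_yy : H²(𝕋) → L²(𝕋)`. -/
def dyy : H2 →ₗ[ℂ] L2T where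
  toFun f := ofCoeff (fun j : ℤ => (Complex.I * j) ^ 2 * coeff (f : L2T) j) (mem_H2.1 f.2)
  map_add' f g := coeff_injective fun j => by
    rw [coeff_add, coeff_ofCoeff, coeff_ofCoeff, coeff_ofCoeff, Submodule.coe_add, coeff_add,
      mul_add]
  map_smul' c f := coeff_injective fun j => by
    rw [coeff_smul, coeff_ofCoeff, coeff_ofCoeff, Submodule.coe_smul, coeff_smul,
      RingHom.id_apply]
    ring

theorem coeff_dyy (f : H2) (j : ℤ) :
    coeff (dyy f) j = (Complex.I * j) ^ 2 * coeff (f : L2T) j :=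
  coeff_ofCoeff _ _ j

/-- `D_ε = ∂_yy - ε²` on `H²(𝕋)`. -/
def opD (ε : ℝ) : H2 →ₗ[ℂ] L2T := dyy - ((ε : ℂ) ^ 2) • H2.subtype

theorem invHelmholtz_bound (ε : ℝ) :
    ∀ j : ℤ, ‖(if j = 0 then 0 else ((((j : ℝ) ^ 2 + ε ^ 2)⁻¹ : ℝ) : ℂ))‖ ≤ 1 := by
  intro j
  split_ifs with hj
  · simp
  · have h1 : (1 : ℝ) ≤ (j : ℝ) ^ 2 := by
      have : (1 : ℤ) ≤ j ^ 2 := by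
        have := sq_nonneg j
        have h2 : j ^ 2 ≠ 0 := pow_ne_zero 2 hj
        omega
      exact_mod_cast this
    have h2 : (1 : ℝ) ≤ (j : ℝ) ^ 2 + ε ^ 2 := by nlinarith [sq_nonneg ε]
    rw [Complex.norm_real, Real.norm_of_nonneg (inv_nonneg.2 (by linarith))]
    exact inv_le_one_of_one_le₀ h2

/-- `(-∂_yy + ε²)⁻¹ Π_≠`, the Fourier multiplier with symbol `1 / (j² + ε²)` for `j ≠ 0` and
`0` for `j = 0`. See `invHelmholtz_mem` and `neg_opD_invHelmholtz`. -/
def invHelmholtz (ε : ℝ) : L2T →L[ℂ] L2T :=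
  multiplier (fun j => if j = 0 then 0 else ((((j : ℝ) ^ 2 + ε ^ 2)⁻¹ : ℝ) : ℂ))
    ⟨1, invHelmholtz_bound ε⟩

theorem invHelmholtz_mem (ε : ℝ) (f : L2T) : invHelmholtz ε f ∈ H2 := by
  have h := memℓp_mul_coeff (m := fun j : ℤ => (Complex.I * j) ^ 2 *
    (if j = 0 then 0 else ((((j : ℝ) ^ 2 + ε ^ 2)⁻¹ : ℝ) : ℂ))) (B := 1) (fun j => by
      split_ifs with hj
      · simp
      · have hj' : (0 : ℝ) < (j : ℝ) ^ 2 := by positivity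
        have h2 : (0 : ℝ) < (j : ℝ) ^ 2 + ε ^ 2 := by positivity
        rw [norm_mul, norm_pow, norm_mul, Complex.norm_I, one_mul, Complex.norm_intCast, sq_abs,
          Complex.norm_real, Real.norm_of_nonneg (inv_nonneg.2 h2.le), ← div_eq_mul_inv,
          div_le_one h2]
        nlinarith [sq_nonneg ε]) f
  change Memℓp (fun j : ℤ => (Complex.I * j) ^ 2 * coeff (invHelmholtz ε f) j) 2
  simp only [invHelmholtz, coeff_multiplier]
  convert h using 1
  ext j
  ring

/-- `(-∂_yy + ε²) ((-∂_yy + ε²)⁻¹ Π_≠ f) = Π_≠ f`. -/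
theorem neg_opD_invHelmholtz (ε : ℝ) (f : L2T) :
    -(opD ε ⟨invHelmholtz ε f, invHelmholtz_mem ε f⟩) = projNonzero f := by
  refine coeff_injective fun j => ?_
  have h : -(opD ε ⟨invHelmholtz ε f, invHelmholtz_mem ε f⟩)
      = (-1 : ℂ) • dyy ⟨invHelmholtz ε f, invHelmholtz_mem ε f⟩
        + ((ε : ℂ) ^ 2) • invHelmholtz ε f := by
    simp only [opD, LinearMap.sub_apply, LinearMap.smul_apply, Submodule.subtype_apply, neg_smul,
      one_smul]
    abel
  rw [h, coeff_add, coeff_smul, coeff_smul, coeff_projNonzero]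
  rw [coeff_dyy]
  simp only [invHelmholtz, coeff_multiplier]
  split_ifs with hj
  · simp
  · have hj' : (0 : ℝ) < (j : ℝ) ^ 2 + ε ^ 2 := by positivity
    have h3 : ((j : ℂ) ^ 2 + (ε : ℂ) ^ 2) ≠ 0 := by exact_mod_cast hj'.ne'
    push_cast
    rw [mul_pow, Complex.I_sq]
    field_simp

/-- `∂_y⁻¹`, the Fourier multiplier with symbol `1 / (ij)` for `j ≠ 0`; on functions with zero
average it gives the primitive with zero average. -/
def invDy : L2T →L[ℂ] L2T :=
  multiplier (fun j => if j = 0 then 0 else (Complex.I * j)⁻¹) ⟨1, fun j => by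
    split_ifs with hj
    · simp
    · have h1 : (1 : ℝ) ≤ |(j : ℝ)| := by exact_mod_cast Int.one_le_abs hj
      rw [norm_inv, norm_mul, Complex.norm_I, one_mul, Complex.norm_intCast]
      exact inv_le_one_of_one_le₀ h1⟩

/-! ### Shear profiles -/

/-- A real function in `C²(𝕋)`, as a `2π`-periodic `C²` function on `ℝ`. -/
structure Profile where
  toFun : ℝ → ℝ
  contDiff : ContDiff ℝ 2 toFun
  periodic : Function.Periodic toFun (2 * π)

/-- A continuous `2π`-periodic real function as a complex-valued continuous function on `𝕋`. -/
def toTorus (g : ℝ → ℝ) (hg : Continuous g) (hp : Function.Periodic g (2 * π)) : C(Torus, ℂ) where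
  toFun x := ((hp.lift x : ℝ) : ℂ)
  continuous_toFun := Complex.continuous_ofReal.comp (continuous_coinduced_dom.mpr hg)

namespace Profile

/-- The average of `U` vanishes. -/
def ZeroMean (U : Profile) : Prop := ∫ y in (0 : ℝ)..(2 * π), U.toFun y = 0

/-- `‖U‖_{C²} = sup |U| + sup |U'| + sup |U''|`. -/
def normC2 (U : Profile) : ℝ :=
  (⨆ y, |U.toFun y|) + (⨆ y, |deriv U.toFun y|) + ⨆ y, |deriv (deriv U.toFun) y|

theorem continuous_deriv2 (U : Profile) : Continuous (deriv (deriv U.toFun)) := by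
  have h := U.contDiff.continuous_iteratedDeriv 2 le_rfl
  rwa [iteratedDeriv_succ, iteratedDeriv_one] at h

theorem periodic_deriv {g : ℝ → ℝ} {T : ℝ} (hg : Function.Periodic g T) :
    Function.Periodic (deriv g) T := fun x => by
  have h : (fun y => g (y + T)) = g := funext hg
  rw [← deriv_comp_add_const, h]

/-- `U` as a function on the torus. -/
def fn (U : Profile) : C(Torus, ℂ) := toTorus U.toFun U.contDiff.continuous U.periodic

/-- `U''` as a function on the torus. -/
def fn'' (U : Profile) : C(Torus, ℂ) :=
  toTorus (deriv (deriv U.toFun)) U.continuous_deriv2 (periodic_deriv (periodic_deriv U.periodic))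

end Profile

/-- A continuous function on the torus as an element of `L²(𝕋)`. -/
def toL2 (a : C(Torus, ℂ)) : L2T := ContinuousMap.toLp 2 AddCircle.haarAddCircle ℂ a

/-- The operator of multiplication by a continuous function on `L²(𝕋)`. -/
def mulOp (a : C(Torus, ℂ)) : L2T →L[ℂ] L2T :=
  (ContinuousLinearMap.mul ℂ ℂ).holderL AddCircle.haarAddCircle ∞ 2 2
    (ContinuousMap.toLp ∞ AddCircle.haarAddCircle ℂ a)

theorem coeFn_mulOp (a : C(Torus, ℂ)) (f : L2T) :
    (mulOp a f : Torus → ℂ) =ᵐ[AddCircle.haarAddCircle] fun x => a x * f x := by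
  have h1 := (ContinuousLinearMap.mul ℂ ℂ).coeFn_holder (r := 2)
    (ContinuousMap.toLp (E := ℂ) ∞ (AddCircle.haarAddCircle : Measure Torus) ℂ a) f
  have h2 := ContinuousMap.coeFn_toLp (E := ℂ) (p := ∞) (𝕜 := ℂ)
    (AddCircle.haarAddCircle : Measure Torus) a
  filter_upwards [h1, h2] with x hx1 hx2
  rw [← hx2]
  exact hx1

/-! ### The operators -/

/-- `M_{ν,ε} = ν D_ε - (i / ε) U'' Π₀` on `H²(𝕋)`. -/
def opM (U : Profile) (ν ε : ℝ) : H2 →ₗ[ℂ] L2T :=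
  (ν : ℂ) • opD ε - (Complex.I / ε) • ((mulOp U.fn'' ∘L projZero : L2T →ₗ[ℂ] L2T) ∘ₗ H2.subtype)

/-- `R_ε = U + U'' (-∂_yy + ε²)⁻¹ Π_≠` on `L²(𝕋)`. -/
def opR (U : Profile) (ε : ℝ) : L2T →L[ℂ] L2T :=
  mulOp U.fn + mulOp U.fn'' ∘L invHelmholtz ε

/-- `L_{ν,ε} = M_{ν,ε} - i ε R_ε`, an unbounded operator on `L²(𝕋)` with domain `H²(𝕋)`. -/
def opL (U : Profile) (ν ε : ℝ) : L2T →ₗ.[ℂ] L2T where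
  domain := H2
  toFun := opM U ν ε - (Complex.I * ε) • ((opR U ε : L2T →ₗ[ℂ] L2T) ∘ₗ H2.subtype)

/-! ### Spectrum of an unbounded operator -/

section Spectrum

variable {H : Type*} [NormedAddCommGroup H] [NormedSpace ℂ H]

/-- `A - z` on the domain of `A`. -/
def shift (A : H →ₗ.[ℂ] H) (z : ℂ) : A.domain →ₗ[ℂ] H := A.toFun - z • A.domain.subtype

/-- `z` is in the resolvent set of `A` if `A - z` has a bounded two-sided inverse. -/
def resolventSet (A : H →ₗ.[ℂ] H) : Set ℂ :=
  {z | ∃ R : H →L[ℂ] H,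
    (∀ f, ∃ h : R f ∈ A.domain, shift A z ⟨R f, h⟩ = f) ∧ ∀ v : A.domain, R (shift A z v) = v}

/-- The spectrum of `A`, the complement of the resolvent set. -/
def spectrum (A : H →ₗ.[ℂ] H) : Set ℂ := (resolventSet A)ᶜ

/-- The kernel of `(A - z)ⁿ`, on its natural domain. -/
def kerPow (A : H →ₗ.[ℂ] H) (z : ℂ) : ℕ → Submodule ℂ H
  | 0 => ⊥
  | n + 1 => ((kerPow A z n).comap (shift A z)).map A.domain.subtype

/-- The generalized eigenspace, the union of the kernels of `(A - z)ⁿ`. -/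
def genEigenspace (A : H →ₗ.[ℂ] H) (z : ℂ) : Submodule ℂ H := ⨆ n, kerPow A z n

/-- The algebraic multiplicity of `z` as an eigenvalue of `A`. -/
def algMultiplicity (A : H →ₗ.[ℂ] H) (z : ℂ) : Cardinal := Module.rank ℂ (genEigenspace A z)

/-- `z` is an (algebraically) simple eigenvalue of `A`. -/
def IsSimpleEigenvalue (A : H →ₗ.[ℂ] H) (z : ℂ) : Prop := algMultiplicity A z = 1

/-- `V` is an eigenvector of `A` with eigenvalue `z`. -/
def IsEigenvector (A : H →ₗ.[ℂ] H) (z : ℂ) (V : H) : Prop :=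
  V ≠ 0 ∧ ∃ h : V ∈ A.domain, A ⟨V, h⟩ = z • V

end Spectrum

end OrrSommerfeld

end

/-! For `ε ≪ ν` the operator should be a small perturbation of the diagonal operator `ν(∂_yy - ε²)`,
with eigenvalues `-ν(j² + ε²)`: simple for `j = 0`, double for `±j`, and separated by gaps of size
at least `ν`. The term `(i/ε) U'' Π₀` is the obstacle, being large. It only maps the mean to nonzero
modes, while the way back is weak: integrating by parts, the mean of `R_ε f` is `ε² ⟨U, (-∂_yy +
ε²)⁻¹ Π_≠ f⟩` (`Profile.coeff_zero_opR`). Conjugating by the map that multiplies the mean by `(1 +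
ε²)/ε²` balances the two couplings. It commutes with the diagonal part and leaves a bounded part of
norm at most `4εK` (`norm_conj_boundedPart_le`); spectrum and multiplicities are unchanged.

The perturbation theory is done by block diagonalization rather than contour integrals. Near an
isolated semisimple eigenvalue `c` with projection `P` and reduced resolvent `G`, a contraction
gives `X`, from the range of `P` to its kernel, whose graph is invariant under `A + B`
(`exists_riccati`). The complementary block is inverted by a Neumann series, so near `c` the
spectrum with multiplicities is that of a matrix on the range of `P`
(`IsReducedResolvent.exists_eigenvalues`). Applying this to each pair of modes `±n`, and with `P =
0` far from the unperturbed eigenvalues, gives the whole family (`exists_eigenvalue_family`).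

The eigenvalue near `-νε²` is then computed by hand (`eigenpair_estimates`). Its eigenvector has
nonzero mean; normalize it to `-iνε`. In the nonzero modes the large term becomes `-νU''`, balanced
at leading order by the component `U`, so `V = U - iνε + h` with `h` small. The zero mode gives
exactly `λ + νε² = (ε²/ν) ⟨U, (-∂_yy + ε²)⁻¹ (U + h)⟩`, whose leading term is `(ε²/ν) ‖∂_y⁻¹ U‖²`.
-/

namespace OrrSommerfeld

/-! ### Unbounded operators described through their graphs. -/

section GraphDescription

variable {H : Type*} [NormedAddCommGroup H] [NormedSpace ℂ H]

theorem mem_kerPow_succ {A : H →ₗ.[ℂ] H} {z : ℂ} {k : ℕ} {v : H} :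
    v ∈ kerPow A z (k + 1) ↔ ∃ w, (v, w) ∈ A.graph ∧ w - z • v ∈ kerPow A z k := by
  simp only [kerPow, Submodule.mem_map, Submodule.mem_comap, LinearPMap.mem_graph_iff]
  constructor
  · rintro ⟨x, hx, rfl⟩
    exact ⟨A x, ⟨x, rfl, rfl⟩, hx⟩
  · rintro ⟨w, ⟨x, hx, hw⟩, h⟩
    subst hx hw
    exact ⟨x, h, rfl⟩

theorem mem_resolventSet_iff {A : H →ₗ.[ℂ] H} {z : ℂ} :
    z ∈ resolventSet A ↔ ∃ R : H →L[ℂ] H, (∀ f, (R f, f + z • R f) ∈ A.graph) ∧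
      ∀ v w, (v, w) ∈ A.graph → R (w - z • v) = v := by
  constructor
  · rintro ⟨R, h1, h2⟩
    refine ⟨R, fun f => ?_, fun v w h => ?_⟩
    · obtain ⟨hf, e⟩ := h1 f
      rw [LinearPMap.mem_graph_iff]
      refine ⟨⟨R f, hf⟩, rfl, ?_⟩
      have e' : A ⟨R f, hf⟩ - z • R f = f := e
      exact sub_eq_iff_eq_add.1 e'
    · obtain ⟨x, hx, hw⟩ := LinearPMap.mem_graph_iff A |>.1 h
      dsimp only at hx hw
      subst hx hw
      exact h2 x
  · rintro ⟨R, h1, h2⟩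
    refine ⟨R, fun f => ?_, fun v => ?_⟩
    · obtain ⟨x, hx, hw⟩ := LinearPMap.mem_graph_iff A |>.1 (h1 f)
      dsimp only at hx hw
      have hm : R f ∈ A.domain := hx ▸ x.2
      refine ⟨hm, ?_⟩
      have e : (⟨R f, hm⟩ : A.domain) = x := Subtype.ext hx.symm
      change A ⟨R f, hm⟩ - z • R f = f
      rw [e, hw, add_sub_cancel_right]
    · exact h2 v _ (LinearPMap.mem_graph A v)

theorem isEigenvector_iff {A : H →ₗ.[ℂ] H} {z : ℂ} {v : H} :
    IsEigenvector A z v ↔ v ≠ 0 ∧ (v, z • v) ∈ A.graph := by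
  refine and_congr_right fun _ => ?_
  rw [LinearPMap.mem_graph_iff]
  constructor
  · rintro ⟨h, e⟩
    exact ⟨⟨v, h⟩, rfl, e⟩
  · rintro ⟨x, hx, hw⟩
    dsimp only at hx hw
    subst hx
    exact ⟨x.2, hw⟩

/-- The perturbation `A + B` of an unbounded operator by a bounded one. -/
def perturb (A : H →ₗ.[ℂ] H) (B : H →L[ℂ] H) : H →ₗ.[ℂ] H where
  domain := A.domain
  toFun := A.toFun + (B : H →ₗ[ℂ] H) ∘ₗ A.domain.subtype

theorem mem_graph_perturb {A : H →ₗ.[ℂ] H} {B : H →L[ℂ] H} {v w : H} :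
    (v, w) ∈ (perturb A B).graph ↔ (v, w - B v) ∈ A.graph := by
  simp only [LinearPMap.mem_graph_iff]
  constructor
  · rintro ⟨x, hx, hw⟩
    refine ⟨x, hx, ?_⟩
    have hw' : A x + B x = w := hw
    have hx' : (x : H) = v := hx
    change A x = w - B v
    rw [← hw', ← hx', add_sub_cancel_right]
  · rintro ⟨x, hx, hw⟩
    refine ⟨x, hx, ?_⟩
    change A x + B x = w
    have hx' : (x : H) = v := hx
    have hw' : A x = w - B v := hw
    rw [hw', hx', sub_add_cancel]

theorem kerPow_eq_bot_of_mem_resolventSet {A : H →ₗ.[ℂ] H} {z : ℂ} (hz : z ∈ resolventSet A) :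
    kerPow A z 1 = ⊥ := by
  obtain ⟨R, -, hR⟩ := mem_resolventSet_iff.1 hz
  refine (Submodule.eq_bot_iff _).2 fun v hv => ?_
  obtain ⟨w, hvw, h⟩ := mem_kerPow_succ.1 hv
  have h0 : w - z • v = 0 := h
  rw [← hR v w hvw, h0, map_zero]

/-- If `A - z` is injective, induction makes the kernel of every power trivial. -/
theorem exists_isEigenvector_of_algMultiplicity_ne_zero {A : H →ₗ.[ℂ] H} {z : ℂ}
    (hz : algMultiplicity A z ≠ 0) : ∃ v, IsEigenvector A z v := by
  by_contra! hno
  have h1 : ∀ v w, (v, w) ∈ A.graph → w - z • v = 0 → v = 0 := fun v w hvw h => by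
    by_contra hv
    exact hno v (isEigenvector_iff.2 ⟨hv, sub_eq_zero.1 h ▸ hvw⟩)
  have h2 : ∀ k, kerPow A z k = ⊥ := fun k => by
    induction k with
    | zero => rfl
    | succ k ih =>
      refine (Submodule.eq_bot_iff _).2 fun v hv => ?_
      obtain ⟨w, hvw, h⟩ := mem_kerPow_succ.1 hv
      rw [ih, Submodule.mem_bot] at h
      exact h1 v w hvw h
  apply hz
  rw [algMultiplicity, genEigenspace, iSup_congr h2, iSup_bot, rank_bot]

end GraphDescription

/-! ### Invariance of spectrum and multiplicity under bounded similarity. -/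

section Similarity

variable {H : Type*} [NormedAddCommGroup H] [NormedSpace ℂ H] {A A' : H →ₗ.[ℂ] H}

theorem algMultiplicity_eq_of_similar (S : H ≃L[ℂ] H)
    (hS : ∀ v w, (v, w) ∈ A.graph ↔ (S v, S w) ∈ A'.graph) (z : ℂ) :
    algMultiplicity A z = algMultiplicity A' z := by
  have h1 : ∀ k v, v ∈ kerPow A z k ↔ S v ∈ kerPow A' z k := fun k => by
    induction k with
    | zero => intro v; change v = 0 ↔ S v = 0; simp
    | succ k ih =>
      intro v
      simp only [mem_kerPow_succ, hS, ih, map_sub, map_smul]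
      constructor
      · rintro ⟨w, hw⟩
        exact ⟨S w, hw⟩
      · rintro ⟨w, hw⟩
        exact ⟨S.symm w, by simpa using hw⟩
  have h2 : ∀ k, (kerPow A z k).map (S : H →ₗ[ℂ] H) = kerPow A' z k := fun k => by
    ext v
    rw [Submodule.mem_map]
    constructor
    · rintro ⟨u, hu, rfl⟩
      exact (h1 k u).1 hu
    · intro hv
      exact ⟨S.symm v, (h1 k _).2 (by simpa using hv), by simp⟩
  have h3 : (genEigenspace A z).map (S : H →ₗ[ℂ] H) = genEigenspace A' z := by
    simp only [genEigenspace, Submodule.map_iSup, h2]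
  rw [algMultiplicity, algMultiplicity, ← h3]
  exact (Submodule.equivMapOfInjective _ S.injective _).rank_eq

theorem mem_resolventSet_of_similar (S : H ≃L[ℂ] H)
    (hS : ∀ v w, (v, w) ∈ A.graph ↔ (S v, S w) ∈ A'.graph)
    {z : ℂ} (hz : z ∈ resolventSet A') : z ∈ resolventSet A := by
  obtain ⟨R, h1, h2⟩ := mem_resolventSet_iff.1 hz
  refine mem_resolventSet_iff.2 ⟨(S.symm : H →L[ℂ] H) ∘L R ∘L (S : H →L[ℂ] H),
    fun f => ?_, fun v w h => ?_⟩
  · rw [hS]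
    simpa using h1 (S f)
  · have := h2 _ _ ((hS v w).1 h)
    rw [← map_smul, ← map_sub] at this
    simp only [ContinuousLinearMap.comp_apply, ContinuousLinearEquiv.coe_coe]
    rw [this, S.symm_apply_apply]

theorem spectrum_eq_of_similar (S : H ≃L[ℂ] H)
    (hS : ∀ v w, (v, w) ∈ A.graph ↔ (S v, S w) ∈ A'.graph) :
    spectrum A = spectrum A' := by
  rw [spectrum, spectrum, compl_inj_iff]
  refine Set.Subset.antisymm (fun z hz => ?_) fun z hz => mem_resolventSet_of_similar S hS hz
  refine mem_resolventSet_of_similar S.symm (A := A') (A' := A) (fun v w => ?_) hz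
  rw [hS]
  simp

end Similarity

/-! ### Perturbation of an isolated semisimple eigenvalue by an invariant graph. -/

section ReducedResolvent

variable {H : Type*} [NormedAddCommGroup H] [NormedSpace ℂ H]

/-- `P` is a projection onto a subspace on which `A` acts as the scalar `c`, commuting with `A`,
and `G` inverts `A - c` on the kernel of `P` and vanishes on the range of `P`. -/
structure IsReducedResolvent (A : H →ₗ.[ℂ] H) (c : ℂ) (P G : H →L[ℂ] H) : Prop where
  proj_proj : ∀ f, P (P f) = P f
  proj_res : ∀ f, P (G f) = 0
  proj_mem : ∀ f, (P f, c • P f) ∈ A.graph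
  res_mem : ∀ f, (G f, c • G f + (f - P f)) ∈ A.graph
  res_apply : ∀ v w, (v, w) ∈ A.graph → G (w - c • v) = v - P v
  proj_apply : ∀ v w, (v, w) ∈ A.graph → P w = c • P v

/-- Solution by contraction of the Riccati equation for an invariant graph. -/
theorem exists_riccati [CompleteSpace H] {P G B : H →L[ℂ] H} (hP : ‖P‖ ≤ 1)
    (hB : ‖G‖ * ‖B‖ ≤ 1 / 16) :
    ∃ X : H →L[ℂ] H, ‖X‖ ≤ 1 / 2 ∧ X = G * (X - 1) * B * (1 + X) * P := by
  have h1 : ‖(1 : H →L[ℂ] H)‖ ≤ 1 := ContinuousLinearMap.norm_id_le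
  have hprod : ∀ Y Z : H →L[ℂ] H, ‖G * Y * B * Z * P‖ ≤ 1 / 16 * (‖Y‖ * ‖Z‖) := fun Y Z => by
    calc ‖G * Y * B * Z * P‖ ≤ ‖G‖ * ‖Y‖ * ‖B‖ * ‖Z‖ * ‖P‖ := by
          refine (norm_mul_le _ _).trans (mul_le_mul_of_nonneg_right ?_ (norm_nonneg _))
          refine (norm_mul_le _ _).trans (mul_le_mul_of_nonneg_right ?_ (norm_nonneg _))
          refine (norm_mul_le _ _).trans (mul_le_mul_of_nonneg_right ?_ (norm_nonneg _))
          exact norm_mul_le _ _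
      _ ≤ ‖G‖ * ‖Y‖ * ‖B‖ * ‖Z‖ * 1 := by gcongr
      _ = ‖G‖ * ‖B‖ * (‖Y‖ * ‖Z‖) := by ring
      _ ≤ _ := by gcongr
  set Φ : (H →L[ℂ] H) → (H →L[ℂ] H) := fun X => G * (X - 1) * B * (1 + X) * P with hΦ
  have hadd : ∀ X : H →L[ℂ] H, ‖X‖ ≤ 1 / 2 → ‖1 + X‖ ≤ 3 / 2 := fun X hX =>
    (norm_add_le _ _).trans (by linarith)
  have hsub : ∀ X : H →L[ℂ] H, ‖X‖ ≤ 1 / 2 → ‖X - 1‖ ≤ 3 / 2 := fun X hX =>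
    (norm_sub_le _ _).trans (by linarith)
  -- On the ball of radius `1/2` both factors `X - 1` and `1 + X` have norm at most `3/2`. Hence `Φ`
  -- has size at most `9/64` and Lipschitz constant at most `3/16`.
  have hmaps : Set.MapsTo Φ (Metric.closedBall 0 (1 / 2)) (Metric.closedBall 0 (1 / 2)) := by
    intro X hX
    rw [mem_closedBall_zero_iff] at hX ⊢
    refine (hprod _ _).trans ?_
    have := mul_le_mul (hsub X hX) (hadd X hX) (norm_nonneg _) (by norm_num)
    linarith
  have hcontr : ContractingWith (1 / 2) (hmaps.restrict Φ _ _) := by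
    refine ⟨by norm_num, LipschitzWith.of_dist_le_mul ?_⟩
    rintro ⟨X, hX⟩ ⟨Y, hY⟩
    rw [mem_closedBall_zero_iff] at hX hY
    change dist (Φ X) (Φ Y) ≤ ((1 / 2 : NNReal) : ℝ) * dist X Y
    rw [dist_eq_norm, dist_eq_norm]
    have e : Φ X - Φ Y = G * (X - Y) * B * (1 + X) * P + G * (Y - 1) * B * (X - Y) * P := by
      simp only [hΦ]
      noncomm_ring
    rw [e]
    refine (norm_add_le _ _).trans ((add_le_add (hprod _ _) (hprod _ _)).trans ?_)
    have h2 := mul_le_mul_of_nonneg_left (hadd X hX) (norm_nonneg (X - Y))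
    have h3 := mul_le_mul_of_nonneg_right (hsub Y hY) (norm_nonneg (X - Y))
    have h4 := norm_nonneg (X - Y)
    push_cast
    linarith
  obtain ⟨X, hX, hfix, -⟩ := hcontr.exists_fixedPoint' (x := 0) Metric.isClosed_closedBall.isComplete
    hmaps (by simp) (edist_ne_top _ _)
  exact ⟨X, mem_closedBall_zero_iff.1 hX, hfix.symm⟩

namespace IsReducedResolvent

variable {A : H →ₗ.[ℂ] H} {c : ℂ} {P G B X : H →L[ℂ] H}

/-- The Riccati expression begins with `G`, whose values lie in the kernel of `P`, and ends with
`P`. Hence `P X = 0` and `X P = X`, so `X² = 0`, and `P + X` is the projection onto the graph along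
the kernel of `P`. -/
theorem proj_graph (hA : IsReducedResolvent A c P G) (hX : X = G * (X - 1) * B * (1 + X) * P)
    (f : H) : P (X f) = 0 := by
  have h := congrArg (fun Y : H →L[ℂ] H => P (Y f)) hX
  simpa [hA.proj_res] using h

theorem graph_proj (hA : IsReducedResolvent A c P G) (hX : X = G * (X - 1) * B * (1 + X) * P)
    (f : H) : X (P f) = X f := by
  have h1 := congrArg (fun Y : H →L[ℂ] H => Y (P f)) hX
  have h2 := congrArg (fun Y : H →L[ℂ] H => Y f) hX
  simp only [mul_apply_eq_comp, hA.proj_proj] at h1 h2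
  rw [h1, ← h2]

/-- The graph of `X` over the range of `P` is invariant under `A + B`. -/
theorem invariant (hA : IsReducedResolvent A c P G) (hX : X = G * (X - 1) * B * (1 + X) * P)
    (f : H) : (P f + X f, c • (P f + X f) + (P (B (P f + X f)) + X (B (P f + X f)))) ∈
      (perturb A B).graph := by
  rw [mem_graph_perturb]
  have e : X f = G (X (B (P f + X f)) - B (P f + X f)) := by
    have h := congrArg (fun Y : H →L[ℂ] H => Y f) hX
    simp only [mul_apply_eq_comp, _root_.sub_apply,
      _root_.add_apply, one_apply_eq_self, hA.graph_proj hX] at h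
    exact h
  -- With `v = P f + X f`, the Riccati equation reads `X f = G (X B v - B v)`. Thus `(A - c) X f = X
  -- B v - B v + P B v`, and adding `B v` leaves only the graph vector over `P B v`.
  have h1 := A.graph.add_mem (hA.proj_mem f) (hA.res_mem (X (B (P f + X f)) - B (P f + X f)))
  rw [← e, map_sub, hA.proj_graph hX] at h1
  convert h1 using 1
  rw [Prod.mk_add_mk, smul_add]
  congr 1
  abel

/-- The compression of `A + B` to the invariant graph, in the coordinates of the range of `P`. -/
def compression (c : ℂ) (P B X : H →L[ℂ] H) : Module.End ℂ (LinearMap.range (P : H →ₗ[ℂ] H)) :=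
  c • 1 + (P : H →ₗ[ℂ] H).rangeRestrict ∘ₗ
    ((B ∘L (1 + X) : H →L[ℂ] H) : H →ₗ[ℂ] H) ∘ₗ (LinearMap.range (P : H →ₗ[ℂ] H)).subtype

theorem coe_compression (p : LinearMap.range (P : H →ₗ[ℂ] H)) :
    (compression c P B X p : H) = c • (p : H) + P (B (p + X p)) := by
  simp [compression]

/-- The embedding of the range of `P` as the graph of `X`. -/
def embed (P X : H →L[ℂ] H) : LinearMap.range (P : H →ₗ[ℂ] H) →ₗ[ℂ] H :=
  ((1 + X : H →L[ℂ] H) : H →ₗ[ℂ] H) ∘ₗ (LinearMap.range (P : H →ₗ[ℂ] H)).subtype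

theorem embed_apply (p : LinearMap.range (P : H →ₗ[ℂ] H)) : embed P X p = p + X p := by
  simp [embed]

theorem proj_coe (hA : IsReducedResolvent A c P G) (p : LinearMap.range (P : H →ₗ[ℂ] H)) :
    P p = p := by
  obtain ⟨_, f, rfl⟩ := p
  exact hA.proj_proj f

theorem proj_embed (hA : IsReducedResolvent A c P G) (hX : X = G * (X - 1) * B * (1 + X) * P)
    (p : LinearMap.range (P : H →ₗ[ℂ] H)) : P (embed P X p) = p := by
  rw [embed_apply, map_add, hA.proj_coe, hA.proj_graph hX, add_zero]

theorem embed_injective (hA : IsReducedResolvent A c P G)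
    (hX : X = G * (X - 1) * B * (1 + X) * P) : Function.Injective (embed P X) := fun p q h => by
  apply Subtype.ext
  rw [← hA.proj_embed hX p, h, hA.proj_embed hX]

theorem embed_rangeRestrict (hA : IsReducedResolvent A c P G)
    (hX : X = G * (X - 1) * B * (1 + X) * P) (f : H) :
    embed P X ((P : H →ₗ[ℂ] H).rangeRestrict f) = P f + X f := by
  rw [embed_apply]
  simp [hA.graph_proj hX]

theorem embed_mem_graph (hA : IsReducedResolvent A c P G)
    (hX : X = G * (X - 1) * B * (1 + X) * P) (p : LinearMap.range (P : H →ₗ[ℂ] H)) :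
    (embed P X p, embed P X (compression c P B X p)) ∈ (perturb A B).graph := by
  have h := hA.invariant hX (p : H)
  have e : embed P X (compression c P B X p) = c • (p + X p) +
      (P (B (p + X p)) + X (B (p + X p))) := by
    rw [embed_apply, coe_compression, map_add X, map_smul X, hA.graph_proj hX]
    module
  rw [hA.proj_coe] at h
  rwa [e, embed_apply]

/-- The reduction of the equation `(A + B - z) v = f` to the complement of the invariant graph. -/
theorem complement_eq (hA : IsReducedResolvent A c P G)
    (hX : X = G * (X - 1) * B * (1 + X) * P) {v w : H} (hvw : (v, w) ∈ (perturb A B).graph)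
    (z : ℂ) :
    (1 - G * ((z - c) • 1 - (1 - P - X) * B) : H →L[ℂ] H) (v - (P v + X v))
      = G ((w - z • v) - (P (w - z • v) + X (w - z • v))) := by
  set q := v - (P v + X v) with hq
  have hPq : P q = 0 := by
    rw [hq, map_sub, map_add, hA.proj_proj, hA.proj_graph hX, add_zero, sub_self]
  have hXq : X q = 0 := by rw [← hA.graph_proj hX, hPq, map_zero]
  set u := c • (P v + X v) + (P (B (P v + X v)) + X (B (P v + X v))) with hu
  have hgu : (P v + X v, u) ∈ (perturb A B).graph := hA.invariant hX v
  have hgq : (q, w - u) ∈ (perturb A B).graph := (perturb A B).graph.sub_mem hvw hgu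
  -- Subtracting the invariant graph part leaves `q` in the kernel of `P`, where `G` inverts `A -
  -- c`.
  have hgA := mem_graph_perturb.1 hgq
  have hr := hA.res_apply _ _ hgA
  have hp := hA.proj_apply _ _ hgA
  rw [hPq, smul_zero] at hp
  have hx : X (w - u - B q) = 0 := by rw [← hA.graph_proj hX, hp, map_zero]
  rw [hPq, sub_zero] at hr
  have hPu : P u + X u = u := by
    have e1 : P u = c • P v + P (B (P v + X v)) := by
      rw [hu, map_add P, map_smul P, map_add P (P v), map_add P (P (B _)), hA.proj_proj,
        hA.proj_proj, hA.proj_graph hX, hA.proj_graph hX, add_zero, add_zero]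
    rw [← hA.graph_proj hX u, e1, map_add X, map_smul X, hA.graph_proj hX, hA.graph_proj hX, hu]
    module
  have hw : P w + X w = u + P (B q) + X (B q) := by
    rw [map_sub, map_sub, sub_eq_zero] at hp hx
    have e1 : P w = P u + P (B q) := by rw [← hp]; abel
    have e2 : X w = X u + X (B q) := by rw [← hx]; abel
    rw [e1, e2]
    nth_rewrite 3 [← hPu]
    abel
  have key : (w - z • v) - (P (w - z • v) + X (w - z • v)) = (w - u - B q - c • q)
      - ((z - c) • q - (B q - P (B q) - X (B q))) := by
    have : (w - z • v) - (P (w - z • v) + X (w - z • v)) = w - (P w + X w) - z • q := by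
      simp only [map_sub, map_smul, hq]
      module
    rw [this, hw]
    module
  rw [key, map_sub G, hr]
  simp

/-- Generalized eigenvectors lie on the invariant graph: if `(A + B - z) v` is on it, the right side
in `complement_eq` vanishes, and invertibility of the operator on the left gives `v = P v + X v`. On
the graph, `embed` intertwines `A + B` with the compression. -/
theorem mem_kerPow_iff (hA : IsReducedResolvent A c P G)
    (hX : X = G * (X - 1) * B * (1 + X) * P) {z : ℂ}
    (hN : IsUnit (1 - G * ((z - c) • 1 - (1 - P - X) * B) : H →L[ℂ] H)) (k : ℕ) (v : H) :
    v ∈ kerPow (perturb A B) z k ↔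
      ∃ p, ((compression c P B X - z • 1) ^ k) p = 0 ∧ embed P X p = v := by
  induction k generalizing v with
  | zero =>
    change v = 0 ↔ _
    constructor
    · rintro rfl
      exact ⟨0, by simp, map_zero _⟩
    · rintro ⟨p, hp, rfl⟩
      have hp' : p = 0 := by simpa using hp
      rw [hp', map_zero]
  | succ k ih =>
    rw [mem_kerPow_succ]
    constructor
    · rintro ⟨w, hvw, h⟩
      obtain ⟨p, hp, e⟩ := (ih _).1 h
      have hv : v = P v + X v := by
        have h1 := hA.complement_eq hX hvw z
        rw [← e, ← hA.graph_proj hX (embed P X p), hA.proj_embed hX, ← embed_apply, sub_self,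
          map_zero] at h1
        obtain ⟨u, hu⟩ := hN
        have h2 := congrArg (fun x => (↑u⁻¹ : H →L[ℂ] H) x) h1
        simp only [← hu, map_zero] at h2
        rw [← mul_apply_eq_comp, Units.inv_mul, one_apply_eq_self, sub_eq_zero] at h2
        exact h2
      set r := (P : H →ₗ[ℂ] H).rangeRestrict v with hr
      have hvr : embed P X r = v := by rw [hr, hA.embed_rangeRestrict hX, ← hv]
      refine ⟨r, ?_, hvr⟩
      have h3 := (perturb A B).graph.sub_mem hvw (hA.embed_mem_graph hX r)
      rw [hvr, Prod.mk_sub_mk, sub_self] at h3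
      have h4 : w = embed P X (compression c P B X r) :=
        -- Both `w` and the embedded image are values of `A + B` at `v`, and the graph is
        -- single-valued.
        sub_eq_zero.1 (LinearPMap.graph_fst_eq_zero_snd _ h3 rfl)
      have h5 : (compression c P B X - z • 1) r = p := by
        apply hA.embed_injective hX
        rw [e, h4, ← hvr]
        simp
      rw [pow_succ, Module.End.mul_apply, h5, hp]
    · rintro ⟨p, hp, rfl⟩
      refine ⟨_, hA.embed_mem_graph hX p, (ih _).2 ⟨(compression c P B X - z • 1) p, ?_, ?_⟩⟩
      · rw [pow_succ, Module.End.mul_apply] at hp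
        exact hp
      · simp

theorem algMultiplicity_eq (hA : IsReducedResolvent A c P G)
    (hX : X = G * (X - 1) * B * (1 + X) * P) {z : ℂ}
    (hN : IsUnit (1 - G * ((z - c) • 1 - (1 - P - X) * B) : H →L[ℂ] H)) :
    algMultiplicity (perturb A B) z =
      Module.rank ℂ ((compression c P B X).maxGenEigenspace z) := by
  have h : genEigenspace (perturb A B) z =
      ((compression c P B X).maxGenEigenspace z).map (embed P X) := by
    rw [genEigenspace, ← Module.End.iSup_genEigenspace_eq, Submodule.map_iSup]
    refine iSup_congr fun k => ?_
    ext v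
    rw [hA.mem_kerPow_iff hX hN, Submodule.mem_map]
    simp only [Module.End.mem_genEigenspace_nat, LinearMap.mem_ker]
  rw [algMultiplicity, h]
  exact (Submodule.equivMapOfInjective _ (hA.embed_injective hX) _).rank_eq.symm

/-- The operator is block triangular for the splitting into the invariant graph and the kernel of
`P`, so inverting the two diagonal blocks inverts it. -/
theorem mem_resolventSet_of_isUnit (hA : IsReducedResolvent A c P G)
    (hX : X = G * (X - 1) * B * (1 + X) * P)
    [FiniteDimensional ℂ (LinearMap.range (P : H →ₗ[ℂ] H))] {z : ℂ}
    (hN : IsUnit (1 - G * ((z - c) • 1 - (1 - P - X) * B) : H →L[ℂ] H))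
    (hM : IsUnit (compression c P B X - z • 1)) : z ∈ resolventSet (perturb A B) := by
  obtain ⟨N, hN'⟩ := hN.exists_right_inv
  obtain ⟨W, hW, hW'⟩ := isUnit_iff_exists.1 hM
  have hker : ∀ v, (v, z • v) ∈ (perturb A B).graph → v = 0 := fun v hv => by
    have h1 : v ∈ kerPow (perturb A B) z 1 :=
      mem_kerPow_succ.2 ⟨_, hv, by rw [sub_self]; exact Submodule.zero_mem _⟩
    obtain ⟨p, hp, rfl⟩ := (hA.mem_kerPow_iff hX hN 1 v).1 h1
    have hp0 : p = 0 := by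
      have h2 := congrArg W hp
      rw [pow_one, map_zero, ← Module.End.mul_apply, hW', Module.End.one_apply] at h2
      exact h2
    rw [hp0, map_zero]
  -- `Q` solves the complementary block. With `q = Q f` one finds `(A + B - z) q = f - (P + X)(f - B
  -- q)`, and the remainder, a graph vector, is removed by `W` acting on `P (f - B q)`.
  set Q : H →L[ℂ] H := N * G * (1 - P - X) with hQ
  set R : H →L[ℂ] H := Q + (1 + X) ∘L (LinearMap.range (P : H →ₗ[ℂ] H)).subtypeL ∘L
    LinearMap.toContinuousLinearMap W ∘L
    P.codRestrict (LinearMap.range (P : H →ₗ[ℂ] H)) (fun f => LinearMap.mem_range_self _ f) ∘L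
    (1 - B * Q) with hR
  have hRf : ∀ f, (R f, f + z • R f) ∈ (perturb A B).graph := fun f => by
    set q := Q f with hq
    set p := W ((P : H →ₗ[ℂ] H).rangeRestrict (f - B q)) with hp
    have hRfe : R f = q + embed P X p := by
      rw [hR, embed_apply]
      simp only [_root_.add_apply, ContinuousLinearMap.comp_apply, ← hq, one_apply_eq_self,
        _root_.sub_apply, mul_apply_eq_comp]
      rfl
    set g := (z - c) • q - (B q - P (B q) - X (B q)) + (f - P f - X f) with hg
    have hqg : q = G g := by
      have h1 := congrArg (fun Y : H →L[ℂ] H => Y (G ((1 - P - X) f))) hN'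
      simp only [mul_apply_eq_comp, one_apply_eq_self] at h1
      have h2 : N (G ((1 - P - X) f)) = q := by simp [hq, hQ]
      rw [h2] at h1
      simp only [_root_.sub_apply, one_apply_eq_self, mul_apply_eq_comp, smul_apply] at h1
      rw [sub_eq_iff_eq_add] at h1
      rw [hg, map_add G, ← h1.trans (add_comm _ _)]
    have hPq : P q = 0 := by rw [hqg, hA.proj_res]
    have hPg : P g = 0 := by
      rw [hg]
      simp only [map_add, map_sub, map_smul, hPq, hA.proj_proj, hA.proj_graph hX]
      simp
    have h3 := hA.res_mem g
    rw [← hqg, hPg, sub_zero] at h3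
    have h4 : (q, c • q + g + B q) ∈ (perturb A B).graph := by
      rw [mem_graph_perturb, add_sub_cancel_right]
      exact h3
    have h5 : embed P X (compression c P B X p) = z • embed P X p +
        (P (f - B q) + X (f - B q)) := by
      have h6 : (compression c P B X - z • 1) p = (P : H →ₗ[ℂ] H).rangeRestrict (f - B q) := by
        rw [hp, ← Module.End.mul_apply, hW, Module.End.one_apply]
      rw [← hA.embed_rangeRestrict hX, ← h6]
      simp
    have h7 := (perturb A B).graph.add_mem h4 (hA.embed_mem_graph hX p)
    rw [h5, Prod.mk_add_mk, ← hRfe] at h7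
    convert h7 using 2
    rw [hRfe, hg]
    simp only [map_sub]
    module
  -- `R` is a right inverse, so it is also a left inverse because `A + B - z` is injective.
  refine mem_resolventSet_iff.2 ⟨R, hRf, fun v w hvw => ?_⟩
  have h1 := (perturb A B).graph.sub_mem (hRf (w - z • v)) hvw
  rw [Prod.mk_sub_mk] at h1
  rw [← sub_eq_zero]
  apply hker
  convert h1 using 2
  rw [smul_sub]
  abel

end IsReducedResolvent

/-- The spectrum of a small bounded perturbation near an isolated eigenvalue of finite
multiplicity. -/
theorem IsReducedResolvent.exists_eigenvalues [CompleteSpace H] {A : H →ₗ.[ℂ] H} {c : ℂ}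
    {P G B : H →L[ℂ] H} (hA : IsReducedResolvent A c P G) (hP : ‖P‖ ≤ 1)
    (hB : ‖G‖ * ‖B‖ ≤ 1 / 16) [FiniteDimensional ℂ (LinearMap.range (P : H →ₗ[ℂ] H))] :
    ∃ s : Multiset ℂ, s.card = Module.finrank ℂ (LinearMap.range (P : H →ₗ[ℂ] H)) ∧
      (∀ z ∈ s, ‖z - c‖ ≤ 3 / 2 * ‖B‖) ∧
      ∀ z, ‖G‖ * ‖z - c‖ ≤ 1 / 2 →
        algMultiplicity (perturb A B) z = s.count z ∧ (z ∈ spectrum (perturb A B) ↔ z ∈ s) := by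
  obtain ⟨X, hXn, hX⟩ := exists_riccati hP hB
  set M := compression c P B X with hM
  have hroot : ∀ z, z ∈ M.charpoly.roots ↔ M.HasEigenvalue z := fun z => by
    rw [Polynomial.mem_roots M.charpoly_monic.ne_zero,
      Module.End.hasEigenvalue_iff_isRoot_charpoly]
  refine ⟨M.charpoly.roots, ?_, fun z hz => ?_, fun z hz => ?_⟩
  · rw [← M.charpoly_natDegree, ← IsAlgClosed.card_roots_eq_natDegree]
  · obtain ⟨p, hp⟩ := ((hroot z).1 hz).exists_hasEigenvector
    have h1 := congrArg (Subtype.val) hp.apply_eq_smul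
    rw [hM, coe_compression, Submodule.coe_smul] at h1
    have h2 : (z - c) • (p : H) = P (B (p + X p)) := by rw [sub_smul, ← h1]; abel
    have hp0 : 0 < ‖(p : H)‖ := norm_pos_iff.2 fun h => hp.2 (Subtype.ext h)
    have h3 : ‖z - c‖ * ‖(p : H)‖ ≤ 3 / 2 * ‖B‖ * ‖(p : H)‖ := by
      rw [← norm_smul, h2]
      calc ‖P (B (p + X p))‖ ≤ 1 * (‖B‖ * (‖(p : H)‖ + 1 / 2 * ‖(p : H)‖)) := by
            refine (P.le_of_opNorm_le hP _).trans ?_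
            gcongr
            refine (B.le_opNorm _).trans ?_
            gcongr
            refine (norm_add_le _ _).trans ?_
            gcongr
            exact X.le_of_opNorm_le hXn _
        _ = _ := by ring
    exact le_of_mul_le_mul_right h3 hp0
  -- The subtracted operator has norm at most `‖G‖ (‖z - c‖ + 5/2 ‖B‖) ≤ 1/2 + 5/32 < 1`.
  · have hN : IsUnit (1 - G * ((z - c) • 1 - (1 - P - X) * B) : H →L[ℂ] H) := by
      apply isUnit_one_sub_of_norm_lt_one
      have h1 : ‖(1 : H →L[ℂ] H)‖ ≤ 1 := ContinuousLinearMap.norm_id_le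
      have h2 : ‖(1 - P - X : H →L[ℂ] H)‖ ≤ 5 / 2 :=
        (norm_sub_le _ _).trans (by linarith [norm_sub_le (1 : H →L[ℂ] H) P])
      have h3 : ‖(z - c) • (1 : H →L[ℂ] H) - (1 - P - X) * B‖ ≤ ‖z - c‖ * 1 + 5 / 2 * ‖B‖ := by
        refine (norm_sub_le _ _).trans (add_le_add ?_ ?_)
        · rw [norm_smul]
          gcongr
        · refine (norm_mul_le _ _).trans ?_
          gcongr
      have h4 := (norm_mul_le G _).trans (mul_le_mul_of_nonneg_left h3 (norm_nonneg G))
      linarith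
    have hmult := hA.algMultiplicity_eq hX hN
    refine ⟨?_, ?_⟩
    · rw [hmult, Polynomial.count_roots, ← LinearMap.finrank_maxGenEigenspace_eq,
        Module.finrank_eq_rank]
    · rw [hroot, Module.End.hasEigenvalue_iff_mem_spectrum, spectrum, Set.mem_compl_iff, not_iff_comm,
        _root_.spectrum.notMem_iff]
      constructor
      · intro h
        refine hA.mem_resolventSet_of_isUnit hX hN ?_
        rw [← IsUnit.neg_iff, neg_sub, ← Algebra.algebraMap_eq_smul_one]
        exact h
      · intro h
        by_contra hu
        rw [← _root_.spectrum.notMem_iff, not_not, ← Module.End.hasEigenvalue_iff_mem_spectrum] at hu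
        obtain ⟨p, hp⟩ := hu.exists_hasEigenvector
        have h1 : embed P X p ∈ kerPow (perturb A B) z 1 :=
          (hA.mem_kerPow_iff hX hN 1 _).2 ⟨p, by simp [← hM, hp.apply_eq_smul], rfl⟩
        rw [kerPow_eq_bot_of_mem_resolventSet h, Submodule.mem_bot] at h1
        exact hp.2 (hA.embed_injective hX (h1.trans (map_zero _).symm))

end ReducedResolvent

/-! ### Fourier coefficients and norms -/

theorem coeff_sub (f g : L2T) (j : ℤ) : coeff (f - g) j = coeff f j - coeff g j := by
  simp [coeff_eq_repr]

theorem norm_coeff_le (f : L2T) (j : ℤ) : ‖coeff f j‖ ≤ ‖f‖ := by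
  rw [coeff_eq_repr, ← LinearIsometryEquiv.norm_map fourierBasis.repr f]
  exact lp.norm_apply_le_norm (by norm_num) _ j

theorem norm_le_mul_norm_of_coeff {f g : L2T} {B : ℝ} (hB : 0 ≤ B)
    (h : ∀ j, ‖coeff f j‖ ≤ B * ‖coeff g j‖) : ‖f‖ ≤ B * ‖g‖ := by
  have h1 : ‖(B : ℂ) • fourierBasis.repr g‖ = B * ‖g‖ := by
    rw [norm_smul, Complex.norm_real, Real.norm_of_nonneg hB, LinearIsometryEquiv.norm_map]
  rw [← h1, ← LinearIsometryEquiv.norm_map fourierBasis.repr f]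
  refine lp.norm_mono (by norm_num) fun j => ?_
  simp only [lp.coeFn_smul, Pi.smul_apply, smul_eq_mul, norm_mul, Complex.norm_real,
    Real.norm_of_nonneg hB, ← coeff_eq_repr]
  exact h j

theorem norm_le_norm_of_coeff {f g : L2T} (h : ∀ j, ‖coeff f j‖ ≤ ‖coeff g j‖) : ‖f‖ ≤ ‖g‖ := by
  simpa using norm_le_mul_norm_of_coeff zero_le_one (fun j => by simpa using h j)

theorem norm_multiplier_le {m : ℤ → ℂ} (hm : ∃ B : ℝ, ∀ j, ‖m j‖ ≤ B) {B : ℝ}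
    (hB : ∀ j, ‖m j‖ ≤ B) : ‖multiplier m hm‖ ≤ B := by
  have hB0 : 0 ≤ B := (norm_nonneg _).trans (hB 0)
  refine ContinuousLinearMap.opNorm_le_bound _ hB0 fun f => ?_
  refine norm_le_mul_norm_of_coeff hB0 fun j => ?_
  rw [coeff_multiplier, norm_mul]
  exact mul_le_mul_of_nonneg_right (hB j) (norm_nonneg _)

theorem hasSum_inner_coeff (f g : L2T) :
    HasSum (fun j => starRingEnd ℂ (coeff f j) * coeff g j) (inner ℂ f g) := by
  have h := lp.hasSum_inner (𝕜 := ℂ) (G := fun _ : ℤ => ℂ) (fourierBasis.repr f) (fourierBasis.repr g)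
  rw [LinearIsometryEquiv.inner_map_map] at h
  simpa only [← coeff_eq_repr, RCLike.inner_apply'] using h

theorem coeff_projZero (f : L2T) (j : ℤ) :
    coeff (projZero f) j = if j = 0 then coeff f 0 else 0 := by
  rw [projZero, coeff_multiplier]
  split_ifs with h
  · rw [h, one_mul]
  · rw [zero_mul]

theorem norm_projNonzero_le (f : L2T) : ‖projNonzero f‖ ≤ ‖f‖ :=
  norm_le_norm_of_coeff fun j => by
    rw [coeff_projNonzero]
    split_ifs <;> simp

theorem coeff_invHelmholtz (ε : ℝ) (f : L2T) (j : ℤ) :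
    coeff (invHelmholtz ε f) j =
      (if j = 0 then 0 else ((((j : ℝ) ^ 2 + ε ^ 2)⁻¹ : ℝ) : ℂ)) * coeff f j :=
  coeff_multiplier _ _ _ _

theorem one_le_sq_of_ne_zero {j : ℤ} (hj : j ≠ 0) : (1 : ℝ) ≤ (j : ℝ) ^ 2 := by
  have h : (1 : ℤ) ≤ j ^ 2 := by
    have h1 := sq_nonneg j
    have h2 := pow_ne_zero 2 hj
    omega
  exact_mod_cast h

theorem norm_invHelmholtz_apply_le (ε : ℝ) (f : L2T) :
    ‖invHelmholtz ε f‖ ≤ (1 + ε ^ 2)⁻¹ * ‖f‖ := by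
  refine norm_le_mul_norm_of_coeff (by positivity) fun j => ?_
  rw [coeff_invHelmholtz, norm_mul]
  refine mul_le_mul_of_nonneg_right ?_ (norm_nonneg _)
  split_ifs with hj
  · rw [norm_zero]; positivity
  · have h1 := one_le_sq_of_ne_zero hj
    rw [Complex.norm_real, Real.norm_of_nonneg (by positivity)]
    gcongr

/-! ### Continuous functions on the torus -/

theorem norm_mulOp_apply_le (a : C(Torus, ℂ)) (f : L2T) : ‖mulOp a f‖ ≤ ‖a‖ * ‖f‖ := by
  refine Lp.norm_le_mul_norm_of_ae_le_mul ?_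
  filter_upwards [coeFn_mulOp a f] with x hx
  rw [hx, norm_mul]
  exact mul_le_mul_of_nonneg_right (a.norm_coe_le_norm x) (norm_nonneg _)

theorem coeFn_toL2 (a : C(Torus, ℂ)) : (toL2 a : Torus → ℂ) =ᵐ[AddCircle.haarAddCircle] a :=
  ContinuousMap.coeFn_toLp _ a

theorem coeff_toL2 (a : C(Torus, ℂ)) (j : ℤ) : coeff (toL2 a) j = fourierCoeff a j :=
  fourierCoeff_toLp a j

theorem norm_toL2_le (a : C(Torus, ℂ)) : ‖toL2 a‖ ≤ ‖a‖ := by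
  have h := ContinuousMap.toLp_norm_le (E := ℂ) (p := 2) (𝕜 := ℂ)
    (AddCircle.haarAddCircle : Measure Torus)
  have h1 : ‖(ContinuousMap.toLp 2 AddCircle.haarAddCircle ℂ : C(Torus, ℂ) →L[ℂ] L2T)‖ ≤ 1 := by
    refine h.trans ?_
    simp [measureUnivNNReal]
  exact (ContinuousLinearMap.le_of_opNorm_le _ h1 a).trans (by rw [one_mul])

theorem coeff_toL2_const (c : ℂ) (j : ℤ) :
    coeff (toL2 (ContinuousMap.const _ c)) j = if j = 0 then c else 0 := by
  have e : (ContinuousMap.const Torus c : Torus → ℂ) = c • (fourier 0 : Torus → ℂ) := by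
    ext x
    simp
  rw [coeff_toL2, e, fourierCoeff.const_smul, fourierCoeff_fourier]
  simp [Pi.single_apply]

theorem mulOp_toL2_const (a : C(Torus, ℂ)) (c : ℂ) :
    mulOp a (toL2 (ContinuousMap.const _ c)) = c • toL2 a := by
  apply Lp.ext
  filter_upwards [coeFn_mulOp a (toL2 (ContinuousMap.const _ c)),
    coeFn_toL2 (ContinuousMap.const _ c), Lp.coeFn_smul c (toL2 a), coeFn_toL2 a] with x h1 h2 h3 h4
  rw [h1, h2, h3, Pi.smul_apply, h4, ContinuousMap.const_apply, smul_eq_mul, mul_comm]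

theorem projZero_eq (f : L2T) : projZero f = toL2 (ContinuousMap.const _ (coeff f 0)) :=
  coeff_injective fun j => by rw [coeff_projZero, coeff_toL2_const]

theorem coeff_zero_mulOp {a : C(Torus, ℂ)} (ha : ∀ x, starRingEnd ℂ (a x) = a x) (f : L2T) :
    coeff (mulOp a f) 0 = inner ℂ (toL2 a) f := by
  rw [coeff, fourierCoeff, L2.inner_def]
  refine integral_congr_ae ?_
  filter_upwards [coeFn_mulOp a f, coeFn_toL2 a] with x h1 h2
  rw [h1, RCLike.inner_apply', h2, ha]
  simp

section ToTorus

variable {g : ℝ → ℝ} (hg : Continuous g) (hp : Function.Periodic g (2 * π))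

theorem toTorus_coe (y : ℝ) : toTorus g hg hp (y : Torus) = g y := rfl

theorem conj_toTorus (x : Torus) : starRingEnd ℂ (toTorus g hg hp x) = toTorus g hg hp x :=
  Complex.conj_ofReal _

theorem norm_toTorus_le : ‖toTorus g hg hp‖ ≤ ⨆ y, |g y| := by
  have hb : BddAbove (Set.range fun y => |g y|) := by
    refine ⟨‖toTorus g hg hp‖, ?_⟩
    rintro _ ⟨y, rfl⟩
    have h := (toTorus g hg hp).norm_coe_le_norm (y : Torus)
    rwa [toTorus_coe, Complex.norm_real] at h
  refine (ContinuousMap.norm_le _ (Real.iSup_nonneg fun y => abs_nonneg _)).2 fun x => ?_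
  obtain ⟨y, rfl⟩ := QuotientAddGroup.mk_surjective x
  change ‖((g y : ℝ) : ℂ)‖ ≤ _
  rw [Complex.norm_real]
  exact le_ciSup hb y

theorem coeff_toL2_toTorus (j : ℤ) :
    coeff (toL2 (toTorus g hg hp)) j =
      (1 / (2 * π) : ℝ) • ∫ y in (0 : ℝ)..2 * π, Complex.exp (-(Complex.I * j) * y) * g y := by
  rw [coeff_toL2, fourierCoeff_eq_intervalIntegral _ _ 0, zero_add]
  congr 1
  refine intervalIntegral.integral_congr fun y _ => ?_
  change fourier (-j) (y : Torus) • toTorus g hg hp (y : Torus) = _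
  rw [toTorus_coe, fourier_coe_apply, smul_eq_mul]
  have hpi : (π : ℂ) ≠ 0 := by exact_mod_cast Real.pi_ne_zero
  congr 2
  push_cast
  field_simp

theorem coeff_toL2_deriv {g' : ℝ → ℝ} (hg' : Continuous g') (hp' : Function.Periodic g' (2 * π))
    (hd : ∀ y, HasDerivAt g (g' y) y) (j : ℤ) :
    coeff (toL2 (toTorus g' hg' hp')) j =
      Complex.I * j * coeff (toL2 (toTorus g hg hp)) j := by
  rw [coeff_toL2_toTorus, coeff_toL2_toTorus, mul_smul_comm]
  congr 1
  have hu : ∀ y : ℝ, HasDerivAt (fun y : ℝ => Complex.exp (-(Complex.I * j) * y))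
      (Complex.exp (-(Complex.I * j) * y) * (-(Complex.I * j) * 1)) y := fun y =>
    ((Complex.ofRealCLM.hasDerivAt (x := y)).const_mul _).cexp
  have hv : ∀ y : ℝ, HasDerivAt (fun y : ℝ => (g y : ℂ)) (g' y : ℂ) y := fun y =>
    (hd y).ofReal_comp
  rw [intervalIntegral.integral_mul_deriv_eq_deriv_mul (fun y _ => hu y) (fun y _ => hv y)
    (Continuous.intervalIntegrable (by fun_prop) _ _)
    ((Complex.continuous_ofReal.comp hg').intervalIntegrable _ _)]
  have e1 : Complex.exp (-(Complex.I * j) * ((2 * π : ℝ) : ℂ)) = 1 := by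
    rw [← Complex.exp_int_mul_two_pi_mul_I (-j)]
    congr 1
    push_cast
    ring
  have e2 : g (2 * π) = g 0 := by simpa using hp 0
  rw [e1, e2, ← intervalIntegral.integral_const_mul]
  simp only [Complex.ofReal_zero, mul_zero, Complex.exp_zero, sub_self, zero_sub]
  rw [← intervalIntegral.integral_neg]
  refine intervalIntegral.integral_congr fun y _ => ?_
  ring

end ToTorus

namespace Profile

variable (U : Profile)

theorem norm_fn_add_norm_fn''_le : ‖U.fn‖ + ‖U.fn''‖ ≤ U.normC2 := by
  have h1 : ‖U.fn‖ ≤ _ := norm_toTorus_le _ _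
  have h2 : ‖U.fn''‖ ≤ _ := norm_toTorus_le _ _
  have h3 : 0 ≤ ⨆ y, |deriv U.toFun y| := Real.iSup_nonneg fun y => abs_nonneg _
  rw [normC2]
  linarith

theorem coeff_fn'' (j : ℤ) : coeff (toL2 U.fn'') j = (Complex.I * j) ^ 2 * coeff (toL2 U.fn) j := by
  have hd : Differentiable ℝ U.toFun := U.contDiff.differentiable (by norm_num)
  have hc : ContDiff ℝ 1 (deriv U.toFun) := by
    have h : ContDiff ℝ (1 + 1) U.toFun := by
      convert U.contDiff using 1
      norm_num
    exact (contDiff_succ_iff_deriv.1 h).2.2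
  have hd' : Differentiable ℝ (deriv U.toFun) := hc.differentiable (by norm_num)
  have h1 : coeff (toL2 U.fn'') j = _ := coeff_toL2_deriv hc.continuous (periodic_deriv U.periodic)
    U.continuous_deriv2 (periodic_deriv (periodic_deriv U.periodic)) (fun y => (hd' y).hasDerivAt) j
  rw [h1, coeff_toL2_deriv U.contDiff.continuous U.periodic hc.continuous
    (periodic_deriv U.periodic) (fun y => (hd y).hasDerivAt) j, fn]
  ring

theorem coeff_fn''_zero : coeff (toL2 U.fn'') 0 = 0 := by
  rw [coeff_fn'']; simp

theorem coeff_fn_zero (hU : U.ZeroMean) : coeff (toL2 U.fn) 0 = 0 := by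
  rw [fn, coeff_toL2_toTorus]
  have h : (∫ y in (0 : ℝ)..2 * π, Complex.exp (-(Complex.I * (0 : ℤ)) * y) * U.toFun y) =
      ((∫ y in (0 : ℝ)..2 * π, U.toFun y : ℝ) : ℂ) := by
    rw [← intervalIntegral.integral_ofReal]
    simp
  rw [h, hU]
  simp

/-- Integration by parts: the average of `U'' w` is the average of `U w''`, here for
`w = (-∂_yy + ε²)⁻¹ f`. -/
theorem coeff_zero_opR (ε : ℝ) (hU : U.ZeroMean) (f : L2T) :
    coeff (opR U ε f) 0 = (ε : ℂ) ^ 2 * inner ℂ (toL2 U.fn) (invHelmholtz ε f) := by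
  have e : coeff (opR U ε f) 0 = inner ℂ (toL2 U.fn) f +
      inner ℂ (toL2 U.fn'') (invHelmholtz ε f) := by
    have h1 : coeff (mulOp U.fn f) 0 = inner ℂ (toL2 U.fn) f := coeff_zero_mulOp (conj_toTorus _ _) f
    have h2 : coeff (mulOp U.fn'' (invHelmholtz ε f)) 0 =
        inner ℂ (toL2 U.fn'') (invHelmholtz ε f) :=
      coeff_zero_mulOp (conj_toTorus _ _) (invHelmholtz ε f)
    rw [← h1, ← h2, opR, _root_.add_apply, coeff_add]
    rfl
  rw [e]
  refine ((hasSum_inner_coeff _ _).add (hasSum_inner_coeff _ _)).unique ?_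
  have h3 := (hasSum_inner_coeff (toL2 U.fn) (invHelmholtz ε f)).mul_left ((ε : ℂ) ^ 2)
  refine h3.congr_fun fun j => ?_
  rw [coeff_fn'', coeff_invHelmholtz]
  split_ifs with hj
  · rw [hj, U.coeff_fn_zero hU]
    simp
  -- The contributions of `U` and `U''` nearly cancel: `1 - j²/(j² + ε²) = ε²/(j² + ε²)`.
  · have hj' : (j : ℝ) ^ 2 + ε ^ 2 ≠ 0 := by positivity
    have hj2 : (j : ℂ) ^ 2 + (ε : ℂ) ^ 2 ≠ 0 := by exact_mod_cast hj'
    push_cast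
    rw [mul_pow, Complex.I_sq, map_mul, map_mul, map_neg, map_one, map_pow, map_intCast]
    field_simp
    ring

end Profile

/-! ### Diagonal operators and their perturbations -/

theorem finrank_range_indicator_multiplier (F : Finset ℤ) {m : ℤ → ℂ} (hm : ∃ B : ℝ, ∀ j, ‖m j‖ ≤ B)
    (h1 : ∀ j ∈ F, m j = 1) (h0 : ∀ j ∉ F, m j = 0) :
    FiniteDimensional ℂ (LinearMap.range (multiplier m hm : L2T →ₗ[ℂ] L2T)) ∧
      Module.finrank ℂ (LinearMap.range (multiplier m hm : L2T →ₗ[ℂ] L2T)) = F.card := by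
  set V := LinearMap.range (multiplier m hm : L2T →ₗ[ℂ] L2T)
  let φ : V →ₗ[ℂ] (F → ℂ) :=
    { toFun := fun v j => coeff v j
      map_add' := fun v w => funext fun j => coeff_add _ _ _
      map_smul' := fun c v => funext fun j => coeff_smul _ _ _ }
  have hinj : Function.Injective φ := by
    rintro ⟨_, f, rfl⟩ ⟨_, g, rfl⟩ h
    refine Subtype.ext (coeff_injective fun j => ?_)
    by_cases hj : j ∈ F
    · exact congrFun h ⟨j, hj⟩
    · change coeff (multiplier m hm f) j = coeff (multiplier m hm g) j
      rw [coeff_multiplier, coeff_multiplier, h0 j hj, zero_mul, zero_mul]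
  have hsurj : Function.Surjective φ := fun a => by
    classical
    have ha : Memℓp (fun j => if h : j ∈ F then a ⟨j, h⟩ else 0) 2 := by
      refine (memℓp_zero (F.finite_toSet.subset fun j hj => ?_)).of_exponent_ge zero_le
      by_contra hF
      exact hj (dif_neg hF)
    refine ⟨⟨_, ofCoeff _ ha, rfl⟩, funext fun j => ?_⟩
    change coeff (multiplier m hm _) j = a j
    rw [coeff_multiplier, coeff_ofCoeff, h1 j j.2, one_mul, dif_pos j.2]
  let e := LinearEquiv.ofBijective φ ⟨hinj, hsurj⟩
  refine ⟨e.symm.finiteDimensional, ?_⟩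
  rw [e.finrank_eq, Module.finrank_fintype_fun_eq_card, Fintype.card_coe]

/-- For a diagonal operator `P` is the indicator multiplier of `F`, and `G` has symbol `(d j - c)⁻¹`
off `F` and `0` on it. The set `F` may be empty, in which case `G` is the resolvent at `c`. -/
theorem exists_isReducedResolvent {A : L2T →ₗ.[ℂ] L2T} {d : ℤ → ℂ}
    (hA : ∀ v w, (v, w) ∈ A.graph ↔ ∀ j, coeff w j = d j * coeff v j) (F : Finset ℤ) {c : ℂ}
    {r : ℝ} (hr : 0 < r) (hF : ∀ j ∈ F, d j = c) (hgap : ∀ j ∉ F, r ≤ ‖d j - c‖) :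
    ∃ P G : L2T →L[ℂ] L2T, IsReducedResolvent A c P G ∧ ‖P‖ ≤ 1 ∧ ‖G‖ ≤ r⁻¹ ∧
      FiniteDimensional ℂ (LinearMap.range (P : L2T →ₗ[ℂ] L2T)) ∧
      Module.finrank ℂ (LinearMap.range (P : L2T →ₗ[ℂ] L2T)) = F.card := by
  have hP : ∀ j, ‖(if j ∈ F then 1 else 0 : ℂ)‖ ≤ 1 := fun j => by split_ifs <;> simp
  have hG : ∀ j, ‖(if j ∈ F then 0 else (d j - c)⁻¹ : ℂ)‖ ≤ r⁻¹ := fun j => by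
    split_ifs with hj
    · rw [norm_zero]; positivity
    · rw [norm_inv]
      exact inv_anti₀ hr (hgap j hj)
  have hne : ∀ j ∉ F, d j - c ≠ 0 := fun j hj => norm_pos_iff.1 (hr.trans_le (hgap j hj))
  obtain ⟨hfin, hrank⟩ := finrank_range_indicator_multiplier F (m := fun j => if j ∈ F then 1 else 0)
    ⟨1, hP⟩ (fun j hj => if_pos hj) (fun j hj => if_neg hj)
  refine ⟨multiplier _ ⟨1, hP⟩, multiplier _ ⟨r⁻¹, hG⟩, ⟨fun f => ?_, fun f => ?_, fun f => ?_,
    fun f => ?_, fun v w h => ?_, fun v w h => ?_⟩, norm_multiplier_le _ hP,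
    norm_multiplier_le _ hG, hfin, hrank⟩
  · refine coeff_injective fun j => ?_
    simp only [coeff_multiplier]
    split_ifs <;> ring
  · refine coeff_injective fun j => ?_
    simp only [coeff_multiplier, coeff_zero]
    split_ifs <;> ring
  · refine (hA _ _).2 fun j => ?_
    simp only [coeff_multiplier, coeff_smul]
    split_ifs with hj
    · rw [hF j hj]
    · ring
  · refine (hA _ _).2 fun j => ?_
    simp only [coeff_multiplier, coeff_smul, coeff_add, coeff_sub]
    split_ifs with hj
    · ring
    · have := hne j hj
      field_simp
      ring
  · have h' := (hA _ _).1 h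
    refine coeff_injective fun j => ?_
    simp only [coeff_multiplier, coeff_smul, coeff_sub, h']
    split_ifs with hj
    · ring
    · have := hne j hj
      field_simp
      ring
  · have h' := (hA _ _).1 h
    refine coeff_injective fun j => ?_
    simp only [coeff_multiplier, coeff_smul, h']
    split_ifs with hj
    · rw [hF j hj]
      ring
    · ring

/-- Serves to label the perturbed eigenvalues, obtained as a multiset of roots, by the Fourier modes
they come from. -/
theorem exists_map_eq_multiset {α β : Type*} [Inhabited β] (F : Finset α) (s : Multiset β)
    (h : s.card = F.card) : ∃ g : α → β, F.val.map g = s := by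
  classical
  induction F using Finset.induction_on generalizing s with
  | empty => exact ⟨default, by simpa using (Multiset.card_eq_zero.1 h).symm⟩
  | insert a F ha ih =>
    rw [Finset.card_insert_of_notMem ha] at h
    obtain ⟨z, hz⟩ := Multiset.card_pos_iff_exists_mem.1 (by omega : 0 < s.card)
    obtain ⟨t, rfl⟩ := Multiset.exists_cons_of_mem hz
    rw [Multiset.card_cons, add_left_inj] at h
    obtain ⟨g, hg⟩ := ih t h
    refine ⟨Function.update g a z, ?_⟩
    rw [Finset.insert_val_of_notMem ha, Multiset.map_cons, Function.update_self, ← hg]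
    congr 1
    refine Multiset.map_congr rfl fun b hb => Function.update_of_ne ?_ _ _
    rintro rfl
    exact ha hb

/-- The eigenvalues of a small bounded perturbation of the diagonal operator with eigenvalues
`-ν (j² + ε²)`. -/
theorem exists_eigenvalue_family {A : L2T →ₗ.[ℂ] L2T} {B : L2T →L[ℂ] L2T} {ν ε : ℝ} (hν : 0 < ν)
    (hA : ∀ v w, (v, w) ∈ A.graph ↔
      ∀ j, coeff w j = ((-(ν * ((j : ℝ) ^ 2 + ε ^ 2)) : ℝ) : ℂ) * coeff v j)
    (hB : ‖B‖ ≤ ν / 32) :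
    ∃ lam : ℤ → ℂ, spectrum (perturb A B) = Set.range lam ∧
      (∀ z, algMultiplicity (perturb A B) z = Cardinal.mk {j : ℤ // lam j = z}) ∧
      ∀ j : ℤ, ‖lam j + ((ν * ((j : ℝ) ^ 2 + ε ^ 2) : ℝ) : ℂ)‖ ≤ ν / 4 := by
  classical
  set d : ℤ → ℂ := fun j => ((-(ν * ((j : ℝ) ^ 2 + ε ^ 2)) : ℝ) : ℂ) with hd
  set F : ℕ → Finset ℤ := fun n => {(n : ℤ), -(n : ℤ)} with hFdef
  have hF : ∀ n j, j ∈ F n ↔ j.natAbs = n := fun n j => by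
    simp only [hFdef, Finset.mem_insert, Finset.mem_singleton]
    omega
  have hgap : ∀ n j, j ∉ F n → ν ≤ ‖d j - d n‖ := fun n j hj => by
    rw [hF] at hj
    have h1 : d j - d n = ((ν * (((n : ℤ) ^ 2 - j ^ 2 : ℤ) : ℝ) : ℝ) : ℂ) := by
      simp only [hd]
      push_cast
      ring
    have h2 : (n : ℤ) ^ 2 - j ^ 2 ≠ 0 := fun h => by
      rw [sub_eq_zero, ← Int.natAbs_eq_iff_sq_eq] at h
      exact hj (by omega)
    rw [h1, Complex.norm_real, norm_mul, Real.norm_of_nonneg hν.le]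
    have h3 : (1 : ℝ) ≤ ‖(((n : ℤ) ^ 2 - j ^ 2 : ℤ) : ℝ)‖ := by
      rw [Real.norm_eq_abs]
      exact_mod_cast Int.one_le_abs h2
    nlinarith
  have hdF : ∀ n, ∀ j ∈ F n, d j = d n := fun n j hj => by
    rw [hF] at hj
    have h2 : (j : ℝ) ^ 2 = (n : ℝ) ^ 2 := by
      have : j ^ 2 = (n : ℤ) ^ 2 := by rw [← hj, Int.natCast_natAbs, sq_abs]
      exact_mod_cast this
    simp only [hd]
    rw [h2]
    simp
  -- The modes `±n` are treated together because they share the eigenvalue `d n`. The displacement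
  -- is at most `3/2 · ν/32 ≤ ν/4`.
  have hloc : ∀ n : ℕ, ∃ g : ℤ → ℂ, (∀ j ∈ F n, ‖g j - d n‖ ≤ ν / 4) ∧
      ∀ z, ‖z - d n‖ ≤ ν / 2 →
        algMultiplicity (perturb A B) z = ((F n).filter fun j => z = g j).card ∧
        (z ∈ spectrum (perturb A B) ↔ ∃ j ∈ F n, g j = z) := fun n => by
    obtain ⟨P, G, hPG, hP, hG, hfin, hrank⟩ :=
      exists_isReducedResolvent hA (F n) hν (hdF n) (hgap n)
    have hGB : ‖G‖ * ‖B‖ ≤ 1 / 16 := by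
      calc ‖G‖ * ‖B‖ ≤ ν⁻¹ * (ν / 32) := by gcongr
        _ ≤ 1 / 16 := by field_simp; norm_num
    obtain ⟨s, hs, hs1, hs2⟩ := hPG.exists_eigenvalues hP hGB
    obtain ⟨g, hg⟩ := exists_map_eq_multiset (F n) s (hs.trans hrank)
    refine ⟨g, fun j hj => ?_, fun z hz => ?_⟩
    · refine (hs1 _ ?_).trans (by linarith)
      rw [← hg]
      exact Multiset.mem_map_of_mem g hj
    · have hz' : ‖G‖ * ‖z - d n‖ ≤ 1 / 2 := by
        calc ‖G‖ * ‖z - d n‖ ≤ ν⁻¹ * (ν / 2) := by gcongr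
          _ ≤ 1 / 2 := by field_simp; norm_num
      obtain ⟨h1, h2⟩ := hs2 z hz'
      rw [h1, h2, ← hg, Multiset.count_map, Multiset.mem_map]
      exact ⟨rfl, Iff.rfl⟩
  choose g hg1 hg2 using hloc
  have hdlam : ∀ j : ℤ, ‖g j.natAbs j - d j‖ ≤ ν / 4 := fun j => by
    have hj : j ∈ F j.natAbs := (hF _ _).2 rfl
    rw [hdF _ j hj]
    exact hg1 _ j hj
  refine ⟨fun j => g j.natAbs j, ?_, fun z => ?_, fun j => ?_⟩
  rotate_left 2
  · have e : g j.natAbs j + ((ν * ((j : ℝ) ^ 2 + ε ^ 2) : ℝ) : ℂ) = g j.natAbs j - d j := by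
      simp only [hd]
      push_cast
      ring
    rw [e]
    exact hdlam j
  all_goals
    have hcases : ∀ z, (∃ n : ℕ, ‖z - d n‖ ≤ ν / 2) ∨ ∀ j, ν / 2 ≤ ‖d j - z‖ := fun z => by
      by_cases h : ∃ n : ℕ, ‖z - d n‖ ≤ ν / 2
      · exact Or.inl h
      · push Not at h
        refine Or.inr fun j => ?_
        rw [hdF j.natAbs j ((hF _ _).2 rfl), norm_sub_rev]
        exact (h _).le
    -- Discs around different `d n` do not interfere: otherwise the gap `ν` would be at most `ν/4 +
    -- ν/2`.
    have hnear : ∀ z (n : ℕ), ‖z - d n‖ ≤ ν / 2 → ∀ j : ℤ, g j.natAbs j = z → j ∈ F n :=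
      fun z n hz j hj => by
        by_contra hjn
        have h1 := hgap n j hjn
        have h2 := hdlam j
        rw [hj, norm_sub_rev] at h2
        have h3 := norm_sub_le_norm_sub_add_norm_sub (d j) z (d n)
        linarith
    have hfar : ∀ z, (∀ j, ν / 2 ≤ ‖d j - z‖) → (∀ j : ℤ, g j.natAbs j ≠ z) ∧
        algMultiplicity (perturb A B) z = 0 ∧ z ∉ spectrum (perturb A B) := fun z hz => by
      -- No modes are selected and `c = z`, so the multiset of eigenvalues is empty. The gap is only
      -- `ν/2`, and `(2/ν)(ν/32) = 1/16` is what fixes the constant `32`.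
      obtain ⟨P, G, hPG, hP, hG, hfin, hrank⟩ :=
        exists_isReducedResolvent hA ∅ (c := z) (r := ν / 2) (by positivity) (by simp)
          (fun j _ => hz j)
      have hGB : ‖G‖ * ‖B‖ ≤ 1 / 16 := by
        calc ‖G‖ * ‖B‖ ≤ (ν / 2)⁻¹ * (ν / 32) := by gcongr
          _ ≤ 1 / 16 := by field_simp; norm_num
      obtain ⟨s, hs, hs1, hs2⟩ := hPG.exists_eigenvalues hP hGB
      rw [hrank, Finset.card_empty, Multiset.card_eq_zero] at hs
      obtain ⟨h1, h2⟩ := hs2 z (by simp)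
      subst hs
      refine ⟨fun j hj => ?_, by simpa using h1, by simpa using h2⟩
      have h3 := hz j
      have h4 := hdlam j
      rw [hj, norm_sub_rev] at h4
      linarith
  · ext z
    rcases hcases z with ⟨n, hn⟩ | h
    · rw [(hg2 n z hn).2]
      constructor
      · rintro ⟨j, hj, rfl⟩
        refine ⟨j, ?_⟩
        change g j.natAbs j = _
        rw [(hF n j).1 hj]
      · rintro ⟨j, hj⟩
        have hjn := hnear z n hn j hj
        refine ⟨j, hjn, ?_⟩
        change g j.natAbs j = z at hj
        rw [← hj, (hF n j).1 hjn]
    · obtain ⟨h1, -, h3⟩ := hfar z h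
      exact ⟨fun hz => absurd hz h3, fun ⟨j, hj⟩ => absurd hj (h1 j)⟩
  · rcases hcases z with ⟨n, hn⟩ | h
    · rw [(hg2 n z hn).1]
      have e : {j : ℤ | g j.natAbs j = z} = ((F n).filter fun j => z = g n j : Finset ℤ) := by
        ext j
        rw [Finset.coe_filter, Set.mem_ofPred_eq, Set.mem_ofPred_eq]
        constructor
        · intro hj
          have hjn := hnear z n hn j hj
          refine ⟨hjn, ?_⟩
          rw [← hj, (hF n j).1 hjn]
        · rintro ⟨hjn, hj⟩
          rw [(hF n j).1 hjn, hj]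
      change _ = Cardinal.mk {j : ℤ | g j.natAbs j = z}
      rw [e]
      exact Cardinal.mk_coe_finset.symm
    · obtain ⟨h1, h2, -⟩ := hfar z h
      rw [h2]
      have : IsEmpty {j : ℤ // g j.natAbs j = z} := ⟨fun j => h1 j j.2⟩
      exact (Cardinal.mk_eq_zero _).symm

/-! ### The Orr–Sommerfeld operator as a perturbation of a diagonal operator -/

/-- `ν (∂_yy - ε²)` as an unbounded operator with domain `H²(𝕋)`. -/
noncomputable def heat (ν ε : ℝ) : L2T →ₗ.[ℂ] L2T where
  domain := H2
  toFun := (ν : ℂ) • opD ε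

/-- The domain condition is automatic: dividing by `ν`, square-summability of `w` and `v` forces
that of `j² v_j`. -/
theorem mem_graph_heat {ν ε : ℝ} (hν : ν ≠ 0) (v w : L2T) : (v, w) ∈ (heat ν ε).graph ↔
    ∀ j, coeff w j = ((-(ν * ((j : ℝ) ^ 2 + ε ^ 2)) : ℝ) : ℂ) * coeff v j := by
  have hcoeff : ∀ (u : H2) j, coeff ((ν : ℂ) • opD ε u) j =
      ((-(ν * ((j : ℝ) ^ 2 + ε ^ 2)) : ℝ) : ℂ) * coeff (u : L2T) j := fun u j => by
    have e : opD ε u = dyy u - ((ε : ℂ) ^ 2) • (u : L2T) := rfl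
    rw [e, coeff_smul, coeff_sub, coeff_smul, coeff_dyy, mul_pow, Complex.I_sq]
    push_cast
    ring
  rw [LinearPMap.mem_graph_iff]
  constructor
  · rintro ⟨x, hx, hw⟩ j
    have hx' : (x : L2T) = v := hx
    have hw' : (ν : ℂ) • opD ε x = w := hw
    rw [← hw', ← hx']
    exact hcoeff x j
  · intro h
    have hv : v ∈ H2 := by
      have h1 : Memℓp (fun j : ℤ => 1 * coeff ((ν : ℂ)⁻¹ • w + ((ε : ℂ) ^ 2) • v) j) 2 :=
        memℓp_mul_coeff (B := 1) (by simp) _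
      rw [mem_H2]
      convert h1 using 1
      ext j
      have hν' : (ν : ℂ) ≠ 0 := by exact_mod_cast hν
      rw [coeff_add, coeff_smul, coeff_smul, h, mul_pow, Complex.I_sq]
      push_cast
      field_simp
      ring
    refine ⟨⟨v, hv⟩, rfl, coeff_injective fun j => ?_⟩
    exact (hcoeff ⟨v, hv⟩ j).trans (h j).symm

/-- The bounded part of `L_{ν,ε}`. -/
noncomputable def boundedPart (U : Profile) (ε : ℝ) : L2T →L[ℂ] L2T :=
  -((Complex.I / ε) • (mulOp U.fn'' ∘L projZero)) - (Complex.I * ε) • opR U ε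

theorem opL_eq_perturb (U : Profile) (ν ε : ℝ) :
    opL U ν ε = perturb (heat ν ε) (boundedPart U ε) := by
  unfold opL perturb heat
  congr 1
  ext1 v
  simp only [opM, boundedPart, LinearMap.sub_apply, LinearMap.add_apply, LinearMap.smul_apply,
    LinearMap.comp_apply, ContinuousLinearMap.coe_coe, _root_.sub_apply, _root_.neg_apply,
    _root_.smul_apply]
  abel

theorem invHelmholtz_projNonzero (ε : ℝ) (f : L2T) :
    invHelmholtz ε (projNonzero f) = invHelmholtz ε f :=
  coeff_injective fun j => by
    rw [coeff_invHelmholtz, coeff_invHelmholtz, coeff_projNonzero]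
    split_ifs <;> simp

theorem norm_opR_le {U : Profile} {K : ℝ} (hK : U.normC2 ≤ K) (ε : ℝ) (f : L2T) :
    ‖opR U ε f‖ ≤ K * ‖f‖ := by
  have h1 := norm_mulOp_apply_le U.fn f
  have h2 := norm_mulOp_apply_le U.fn'' (invHelmholtz ε f)
  have h3 : ‖invHelmholtz ε f‖ ≤ ‖f‖ := by
    refine (norm_invHelmholtz_apply_le ε f).trans (mul_le_of_le_one_left (norm_nonneg _) ?_)
    exact inv_le_one_of_one_le₀ (by nlinarith [sq_nonneg ε])
  calc ‖opR U ε f‖ ≤ ‖mulOp U.fn f‖ + ‖mulOp U.fn'' (invHelmholtz ε f)‖ := norm_add_le _ _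
    _ ≤ ‖U.fn‖ * ‖f‖ + ‖U.fn''‖ * ‖f‖ :=
      add_le_add h1 (h2.trans (mul_le_mul_of_nonneg_left h3 (norm_nonneg _)))
    _ = (‖U.fn‖ + ‖U.fn''‖) * ‖f‖ := by ring
    _ ≤ K * ‖f‖ := by
      gcongr
      exact U.norm_fn_add_norm_fn''_le.trans hK

theorem norm_toL2_fn_le {U : Profile} {K : ℝ} (hK : U.normC2 ≤ K) : ‖toL2 U.fn‖ ≤ K :=
  (norm_toL2_le _).trans (by linarith [U.norm_fn_add_norm_fn''_le, norm_nonneg U.fn''])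

theorem norm_toL2_fn''_le {U : Profile} {K : ℝ} (hK : U.normC2 ≤ K) : ‖toL2 U.fn''‖ ≤ K :=
  (norm_toL2_le _).trans (by linarith [U.norm_fn_add_norm_fn''_le, norm_nonneg U.fn])

theorem norm_inner_invHelmholtz_le {U : Profile} {K : ℝ} (hK : U.normC2 ≤ K) (ε : ℝ) (f : L2T) :
    ‖(inner ℂ (toL2 U.fn) (invHelmholtz ε f) : ℂ)‖ ≤ K * ((1 + ε ^ 2)⁻¹ * ‖f‖) := by
  have h0 : 0 ≤ K := (norm_nonneg _).trans (norm_toL2_fn_le hK)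
  refine (norm_inner_le_norm _ _).trans ?_
  gcongr
  · exact norm_toL2_fn_le hK
  · exact norm_invHelmholtz_apply_le ε f

/-- Separates the action on the mean, which carries the singular factor `1/ε`, from the action on
the nonzero modes, which is of order `ε`. -/
theorem boundedPart_apply (U : Profile) (ε : ℝ) (f : L2T) :
    boundedPart U ε f = -(Complex.I / ε * coeff f 0) • toL2 U.fn''
      - (Complex.I * ε * coeff f 0) • toL2 U.fn - (Complex.I * ε) • opR U ε (projNonzero f) := by
  have e1 : mulOp U.fn'' (projZero f) = coeff f 0 • toL2 U.fn'' := by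
    rw [projZero_eq, mulOp_toL2_const]
  have e2 : mulOp U.fn f = coeff f 0 • toL2 U.fn + mulOp U.fn (projNonzero f) := by
    have e : f = projZero f + projNonzero f := by simp [projNonzero]
    nth_rewrite 1 [e]
    rw [map_add, projZero_eq, mulOp_toL2_const]
  have e3 : opR U ε f = coeff f 0 • toL2 U.fn + opR U ε (projNonzero f) := by
    change mulOp U.fn f + mulOp U.fn'' (invHelmholtz ε f) = coeff f 0 • toL2 U.fn +
      (mulOp U.fn (projNonzero f) + mulOp U.fn'' (invHelmholtz ε (projNonzero f)))
    rw [e2, invHelmholtz_projNonzero, add_assoc]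
  simp only [boundedPart, _root_.sub_apply, _root_.neg_apply, _root_.smul_apply,
    ContinuousLinearMap.comp_apply]
  rw [e1, e3]
  module

/-- Multiplication of the average by `s`. -/
noncomputable def scaleMean (s : ℂ) : L2T →L[ℂ] L2T :=
  multiplier (fun j => if j = 0 then s else 1) ⟨max ‖s‖ 1, fun j => by split_ifs <;> simp⟩

theorem coeff_scaleMean (s : ℂ) (f : L2T) (j : ℤ) :
    coeff (scaleMean s f) j = (if j = 0 then s else 1) * coeff f j :=
  coeff_multiplier _ _ _ _

theorem scaleMean_scaleMean {s t : ℂ} (h : s * t = 1) (f : L2T) :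
    scaleMean s (scaleMean t f) = f :=
  coeff_injective fun j => by
    rw [coeff_scaleMean, coeff_scaleMean]
    split_ifs
    · rw [← mul_assoc, h, one_mul]
    · rw [one_mul, one_mul]

/-- Multiplication of the average by `s ≠ 0`, as an isomorphism. -/
noncomputable def scaleMeanEquiv (s : ℂ) (hs : s ≠ 0) : L2T ≃L[ℂ] L2T :=
  ContinuousLinearEquiv.equivOfInverse (scaleMean s) (scaleMean s⁻¹)
    (fun f => scaleMean_scaleMean (inv_mul_cancel₀ hs) f)
    (fun f => scaleMean_scaleMean (mul_inv_cancel₀ hs) f)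

/-- Rescaling the mean is a Fourier multiplier, so it commutes with the diagonal part and conjugates
only the bounded part. -/
theorem opL_similar (U : Profile) {ν : ℝ} (ε : ℝ) (hν : ν ≠ 0) {s : ℂ} (hs : s ≠ 0) (v w : L2T) :
    (v, w) ∈ (opL U ν ε).graph ↔ (scaleMeanEquiv s hs v, scaleMeanEquiv s hs w) ∈
      (perturb (heat ν ε) (scaleMean s ∘L boundedPart U ε ∘L scaleMean s⁻¹)).graph := by
  change _ ↔ (scaleMean s v, scaleMean s w) ∈ _
  rw [opL_eq_perturb, mem_graph_perturb, mem_graph_perturb]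
  simp only [ContinuousLinearMap.comp_apply, scaleMean_scaleMean (inv_mul_cancel₀ hs)]
  rw [← map_sub, mem_graph_heat hν, mem_graph_heat hν]
  refine forall_congr' fun j => ?_
  rw [coeff_scaleMean, coeff_scaleMean, mul_left_comm]
  have h : (if j = 0 then s else 1) ≠ 0 := by split_ifs <;> simp [hs]
  exact (mul_right_inj' h).symm

/-- After the rescaling of the average, the bounded part is of size `ε`, uniformly. -/
theorem norm_conj_boundedPart_le {U : Profile} (hU : U.ZeroMean) {K : ℝ} (hK : U.normC2 ≤ K)
    {ε : ℝ} (hε : 0 < ε) {s : ℂ} (hs : s = ((1 + ε ^ 2) / ε ^ 2 : ℝ)) :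
    ‖scaleMean s ∘L boundedPart U ε ∘L scaleMean s⁻¹‖ ≤ 4 * (ε * K) := by
  have h0 : 0 ≤ K := (norm_nonneg _).trans (norm_toL2_fn_le hK)
  have hs' : s⁻¹ = ((ε ^ 2 / (1 + ε ^ 2) : ℝ) : ℂ) := by
    rw [hs, ← Complex.ofReal_inv, inv_div]
  refine ContinuousLinearMap.opNorm_le_bound _ (by positivity) fun f => ?_
  set g := projNonzero f with hg
  have e0 : projNonzero (scaleMean s⁻¹ f) = g := coeff_injective fun j => by
    rw [hg, coeff_projNonzero, coeff_projNonzero, coeff_scaleMean]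
    split_ifs
    · rfl
    · rw [one_mul]
  -- The factor `s⁻¹ = ε²/(1 + ε²)` turns `1/ε` into `ε/(1 + ε²)`, and the factor `s` cancels the
  -- `ε²` gained by integration by parts. The choice `s = ε⁻²` would fail for large `ε`, where the
  -- second term would be of order `ε³`; here `1 + ε²` is absorbed by the decay of `invHelmholtz`.
  -- Each of the four terms is at most `εK‖f‖`.
  have e1 : (scaleMean s ∘L boundedPart U ε ∘L scaleMean s⁻¹) f =
      -(Complex.I * (ε / (1 + ε ^ 2) : ℝ) * coeff f 0) • toL2 U.fn''
      - (Complex.I * (ε * (ε ^ 2 / (1 + ε ^ 2)) : ℝ) * coeff f 0) • toL2 U.fn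
      - (Complex.I * ε) • projNonzero (opR U ε g)
      - (Complex.I * (ε * (1 + ε ^ 2) : ℝ) * inner ℂ (toL2 U.fn) (invHelmholtz ε g)) •
        toL2 (ContinuousMap.const _ 1) := by
    refine coeff_injective fun j => ?_
    have hε' : (ε : ℂ) ≠ 0 := by exact_mod_cast hε.ne'
    have hε2 : (1 + (ε : ℂ) ^ 2) ≠ 0 := by
      have : (1 + ε ^ 2 : ℝ) ≠ 0 := by positivity
      exact_mod_cast this
    change coeff (scaleMean s (boundedPart U ε (scaleMean s⁻¹ f))) j = _
    rw [boundedPart_apply, e0, coeff_scaleMean]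
    simp only [coeff_sub, coeff_smul, coeff_scaleMean, coeff_projNonzero, coeff_toL2_const, hs']
    split_ifs with hj
    · subst hj
      rw [U.coeff_fn_zero hU, U.coeff_fn''_zero, U.coeff_zero_opR ε hU, hs]
      push_cast
      field_simp
      ring
    · push_cast
      field_simp
      ring
  have hn : ∀ (r : ℝ) (z : ℂ) (v : L2T), 0 ≤ r → ‖(Complex.I * r * z) • v‖ = r * (‖z‖ * ‖v‖) :=
    fun r z v hr => by
      rw [norm_smul, norm_mul, norm_mul, Complex.norm_I, Complex.norm_real, Real.norm_of_nonneg hr]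
      ring
  have hpos : (0 : ℝ) < 1 + ε ^ 2 := by positivity
  have b1 : ‖-(Complex.I * (ε / (1 + ε ^ 2) : ℝ) * coeff f 0) • toL2 U.fn''‖ ≤ ε * (‖f‖ * K) := by
    rw [neg_smul, norm_neg, hn _ _ _ (by positivity)]
    gcongr
    · exact div_le_self hε.le (by nlinarith)
    · exact norm_coeff_le f 0
    · exact norm_toL2_fn''_le hK
  have b2 : ‖(Complex.I * (ε * (ε ^ 2 / (1 + ε ^ 2)) : ℝ) * coeff f 0) • toL2 U.fn‖ ≤
      ε * (‖f‖ * K) := by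
    rw [hn _ _ _ (by positivity)]
    gcongr
    · exact mul_le_of_le_one_right hε.le ((div_le_one hpos).2 (by linarith))
    · exact norm_coeff_le f 0
    · exact norm_toL2_fn_le hK
  have hgf : ‖g‖ ≤ ‖f‖ := norm_projNonzero_le f
  have b3 : ‖(Complex.I * ε) • projNonzero (opR U ε g)‖ ≤ ε * (‖f‖ * K) := by
    have h1 := hn ε 1 (projNonzero (opR U ε g)) hε.le
    rw [mul_one, norm_one, one_mul] at h1
    rw [h1]
    gcongr
    calc _ ≤ ‖opR U ε g‖ := norm_projNonzero_le _
      _ ≤ K * ‖g‖ := norm_opR_le hK ε g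
      _ ≤ K * ‖f‖ := by gcongr
      _ = ‖f‖ * K := mul_comm _ _
  have b4 : ‖(Complex.I * (ε * (1 + ε ^ 2) : ℝ) * inner ℂ (toL2 U.fn) (invHelmholtz ε g)) •
      toL2 (ContinuousMap.const _ 1)‖ ≤ ε * (‖f‖ * K) := by
    have h1 : ‖toL2 (ContinuousMap.const _ 1)‖ ≤ 1 :=
      (norm_toL2_le _).trans ((ContinuousMap.norm_le _ zero_le_one).2 fun x => by simp)
    rw [hn _ _ _ (by positivity)]
    calc _ ≤ ε * (1 + ε ^ 2) * (K * ((1 + ε ^ 2)⁻¹ * ‖f‖) * 1) := by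
          gcongr
          exact (norm_inner_invHelmholtz_le hK ε g).trans (by gcongr)
      _ = ε * (‖f‖ * K) := by field_simp
  rw [e1]
  refine (norm_sub_le _ _).trans ?_
  have t1 := norm_sub_le (-(Complex.I * (ε / (1 + ε ^ 2) : ℝ) * coeff f 0) • toL2 U.fn''
      - (Complex.I * (ε * (ε ^ 2 / (1 + ε ^ 2)) : ℝ) * coeff f 0) • toL2 U.fn)
      ((Complex.I * ε) • projNonzero (opR U ε g))
  have t2 := norm_sub_le (-(Complex.I * (ε / (1 + ε ^ 2) : ℝ) * coeff f 0) • toL2 U.fn'')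
      ((Complex.I * (ε * (ε ^ 2 / (1 + ε ^ 2)) : ℝ) * coeff f 0) • toL2 U.fn)
  linarith

/-! ### The eigenvalue close to zero and its eigenvector -/

/-- Invertibility of the nonzero modes near the eigenvalue `-ν ε²`. -/
theorem norm_le_of_resolvent_eq {U : Profile} {K : ℝ} (hK : U.normC2 ≤ K) {ν ε : ℝ} (hν : 0 < ν)
    (hε : 0 < ε) (hεK : ε * K ≤ ν / 4) {μ : ℂ} (hμ : ‖μ‖ ≤ ν / 2) {h F : L2T}
    (h0 : coeff h 0 = 0)
    (heq : ∀ j : ℤ, j ≠ 0 → (μ + ν * (j : ℂ) ^ 2) * coeff h j =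
      coeff F j - Complex.I * ε * coeff (opR U ε h) j) : ‖h‖ ≤ 4 / ν * ‖F‖ := by
  have h1 : ‖h‖ ≤ 2 / ν * ‖F - (Complex.I * ε) • opR U ε h‖ := by
    refine norm_le_mul_norm_of_coeff (by positivity) fun j => ?_
    by_cases hj : j = 0
    · rw [hj, h0, norm_zero]
      positivity
    · rw [coeff_sub, coeff_smul, ← heq j hj, norm_mul]
      -- For `j ≠ 0` the diagonal term `ν j² ≥ ν` dominates `‖μ‖ ≤ ν/2`. The term with `opR` then
      -- costs `(2/ν)(ν/4) = 1/2` of `‖h‖` and is absorbed.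
      have h2 : ν / 2 ≤ ‖μ + ν * (j : ℂ) ^ 2‖ := by
        have e : ‖(ν * (j : ℂ) ^ 2 : ℂ)‖ = ν * (j : ℝ) ^ 2 := by
          rw [norm_mul, norm_pow, Complex.norm_real, Complex.norm_intCast, sq_abs,
            Real.norm_of_nonneg hν.le]
        have h3 := norm_sub_le (μ + ν * (j : ℂ) ^ 2) μ
        rw [add_sub_cancel_left, e] at h3
        nlinarith [one_le_sq_of_ne_zero hj]
      calc ‖coeff h j‖ = 2 / ν * (ν / 2 * ‖coeff h j‖) := by field_simp
        _ ≤ _ := by gcongr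
  have h2 : ‖F - (Complex.I * ε) • opR U ε h‖ ≤ ‖F‖ + ν / 4 * ‖h‖ := by
    refine (norm_sub_le _ _).trans ?_
    rw [norm_smul, norm_mul, Complex.norm_I, one_mul, Complex.norm_real, Real.norm_of_nonneg hε.le]
    have h3 := mul_le_mul_of_nonneg_left (norm_opR_le hK ε h) hε.le
    have h4 := mul_le_mul_of_nonneg_right hεK (norm_nonneg h)
    linarith
  have h3 : ‖h‖ ≤ 2 / ν * (‖F‖ + ν / 4 * ‖h‖) := h1.trans (by gcongr)
  have h4 : 2 / ν * (‖F‖ + ν / 4 * ‖h‖) = 2 / ν * ‖F‖ + ‖h‖ / 2 := by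
    field_simp
    ring
  have h5 : 4 / ν * ‖F‖ = 2 * (2 / ν * ‖F‖) := by ring
  linarith

/-- The eigenvalue equation of `L_{ν,ε}` in Fourier coefficients. -/
theorem coeff_eigenvector {U : Profile} {ν ε : ℝ} (hν : 0 < ν) {l : ℂ} {V : L2T}
    (hV : (V, l • V) ∈ (opL U ν ε).graph) (j : ℤ) :
    (l + ν * ε ^ 2 + ν * (j : ℂ) ^ 2) * coeff V j =
      -(Complex.I / ε * coeff V 0) * coeff (toL2 U.fn'') j
      - Complex.I * ε * coeff V 0 * coeff (toL2 U.fn) j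
      - Complex.I * ε * coeff (opR U ε (projNonzero V)) j := by
  rw [opL_eq_perturb, mem_graph_perturb, mem_graph_heat hν.ne'] at hV
  have h := hV j
  rw [boundedPart_apply] at h
  simp only [coeff_sub, coeff_smul] at h
  push_cast at h
  linear_combination h

/-- An eigenvector with zero mean would solve the homogeneous equation on the nonzero modes and so
vanish. The mean can therefore be scaled to `-iνε`, the value for which the term in `U''` produces
`U` at leading order. -/
theorem exists_normalized_eigenvector {U : Profile} {K : ℝ}
    (hK : U.normC2 ≤ K) {ν ε : ℝ} (hν : 0 < ν) (hε : 0 < ε) (hεK : ε * K ≤ ν / 4) {l : ℂ}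
    (hl : ‖l + ν * ε ^ 2‖ ≤ ν / 2) {V₀ : L2T} (hV₀ : IsEigenvector (opL U ν ε) l V₀) :
    ∃ V, IsEigenvector (opL U ν ε) l V ∧ coeff V 0 = -(Complex.I * ν * ε) := by
  obtain ⟨hne, hgr⟩ := isEigenvector_iff.1 hV₀
  have h0 : coeff V₀ 0 ≠ 0 := fun h0 => by
    have hp : projNonzero V₀ = V₀ := coeff_injective fun j => by
      rw [coeff_projNonzero]
      split_ifs with hj
      · rw [hj, h0]
      · rfl
    have h1 := norm_le_of_resolvent_eq hK hν hε hεK hl (F := 0) h0 fun j _ => by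
      have := coeff_eigenvector hν hgr j
      rw [hp, h0] at this
      rw [this, coeff_zero]
      ring
    rw [norm_zero, mul_zero] at h1
    exact hne (norm_le_zero_iff.1 h1)
  have hν' : (ν : ℂ) ≠ 0 := by exact_mod_cast hν.ne'
  have hε' : (ε : ℂ) ≠ 0 := by exact_mod_cast hε.ne'
  refine ⟨(-(Complex.I * ν * ε) / coeff V₀ 0) • V₀, isEigenvector_iff.2 ⟨?_, ?_⟩, ?_⟩
  · exact smul_ne_zero (div_ne_zero (by simp [hν', hε']) h0) hne
  · rw [smul_comm]
    exact (opL U ν ε).graph.smul_mem _ hgr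
  · rw [coeff_smul, div_mul_cancel₀ _ h0]

/-- On nonzero modes, `∂_y⁻¹` is skew-adjoint with square `-(-∂_yy)⁻¹`. This identifies the leading
coefficient of the eigenvalue. -/
theorem norm_sq_invDy (f : L2T) :
    ((‖invDy f‖ ^ 2 : ℝ) : ℂ) = inner ℂ f (invHelmholtz 0 f) := by
  have h1 : inner ℂ (invDy f) (invDy f) = ((‖invDy f‖ ^ 2 : ℝ) : ℂ) := by
    rw [inner_self_eq_norm_sq_to_K]
    push_cast
    rfl
  rw [← h1]
  refine (hasSum_inner_coeff _ _).unique ((hasSum_inner_coeff _ _).congr_fun fun j => ?_)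
  rw [coeff_invHelmholtz, invDy, coeff_multiplier]
  split_ifs with hj
  · simp
  · have hj' : (j : ℂ) ≠ 0 := by exact_mod_cast hj
    rw [map_mul, map_inv₀, map_mul, map_intCast, Complex.conj_I]
    push_cast
    field_simp
    rw [Complex.I_sq]
    ring

theorem norm_invHelmholtz_sub_le (ε : ℝ) (f : L2T) :
    ‖invHelmholtz ε f - invHelmholtz 0 f‖ ≤ ε ^ 2 / (1 + ε ^ 2) * ‖f‖ := by
  refine norm_le_mul_norm_of_coeff (by positivity) fun j => ?_
  rw [coeff_sub, coeff_invHelmholtz, coeff_invHelmholtz, ← sub_mul, norm_mul]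
  refine mul_le_mul_of_nonneg_right ?_ (norm_nonneg _)
  split_ifs with hj
  · rw [sub_zero, norm_zero]
    positivity
  · have h1 := one_le_sq_of_ne_zero hj
    have h2 : (0 : ℝ) < (j : ℝ) ^ 2 := by positivity
    rw [← Complex.ofReal_sub, Complex.norm_real]
    have e : ((j : ℝ) ^ 2 + ε ^ 2)⁻¹ - ((j : ℝ) ^ 2 + 0 ^ 2)⁻¹ =
        -(ε ^ 2 / ((j : ℝ) ^ 2 * ((j : ℝ) ^ 2 + ε ^ 2))) := by
      field_simp
      ring
    rw [e, norm_neg, Real.norm_of_nonneg (by positivity)]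
    gcongr
    nlinarith [sq_nonneg ε]

/-- The bound on the corrector involves the eigenvalue, which involves the corrector `x` again;
smallness of `t K` lets that term be absorbed on the left. -/
theorem le_of_bootstrap {x t K ε : ℝ} (hx : 0 ≤ x) (ht : 0 < t) (hK : 1 ≤ K)
    (htK : 128 * (t * K) ≤ 1) (h : x ≤ 4 * (t ^ 2 * K ^ 2 * (K + x) + ε ^ 2 * K + t * K ^ 2)) :
    x ≤ 16 * K ^ 3 * (t + ε ^ 2) := by
  have htK0 : 0 < t * K := by positivity
  have h1 : (t * K) ^ 2 * x ≤ 1 / 128 * x := mul_le_mul_of_nonneg_right (by nlinarith) hx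
  have h2 : t ^ 2 * K ^ 3 ≤ t * K ^ 3 :=
    mul_le_mul_of_nonneg_right (by nlinarith) (by positivity)
  have h3 : ε ^ 2 * K ≤ ε ^ 2 * K ^ 3 :=
    mul_le_mul_of_nonneg_left (le_self_pow₀ hK (by norm_num)) (sq_nonneg ε)
  have h4 : t * K ^ 2 ≤ t * K ^ 3 :=
    mul_le_mul_of_nonneg_left (pow_le_pow_right₀ hK (by norm_num)) ht.le
  have h5 : 0 ≤ ε ^ 2 * K ^ 3 := by positivity
  have e : t ^ 2 * K ^ 2 * (K + x) = t ^ 2 * K ^ 3 + (t * K) ^ 2 * x := by ring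
  rw [e] at h
  linarith

/-- The eigenvector with average `-iνε` and its eigenvalue. -/
theorem eigenpair_estimates {U : Profile} (hU : U.ZeroMean) {K : ℝ} (hK1 : 1 ≤ K)
    (hK : U.normC2 ≤ K) {ν ε : ℝ} (hν : 0 < ν) (hε : 0 < ε) (hεK : 128 * (ε * K) ≤ ν) {l : ℂ}
    (hl : ‖l + ν * ε ^ 2‖ ≤ ν / 2) {V : L2T} (hV : (V, l • V) ∈ (opL U ν ε).graph)
    (hV0 : coeff V 0 = -(Complex.I * ν * ε)) :
    ‖V - (toL2 U.fn - toL2 (ContinuousMap.const _ (Complex.I * ν * ε)))‖ ≤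
        16 * K ^ 3 * (ε / ν * (1 + ε * ν)) ∧
      ‖l - ((ε ^ 2 / ν * (‖invDy (toL2 U.fn)‖ ^ 2 - ν ^ 2) : ℝ) : ℂ)‖
        ≤ ε ^ 2 / ν * (64 * K ^ 4 * (ε * (ν + ν⁻¹))) := by
  have hν' : (ν : ℂ) ≠ 0 := by exact_mod_cast hν.ne'
  have hε' : (ε : ℂ) ≠ 0 := by exact_mod_cast hε.ne'
  set u := toL2 U.fn with hu
  set h := projNonzero V - u with hh
  set μ := l + ν * ε ^ 2 with hμ
  have hu0 : coeff u 0 = 0 := U.coeff_fn_zero hU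
  have huK : ‖u‖ ≤ K := norm_toL2_fn_le hK
  clear_value h μ
  have hW : projNonzero V = u + h := by rw [hh]; abel
  have hVh : V - (u - toL2 (ContinuousMap.const _ (Complex.I * ν * ε))) = h :=
    coeff_injective fun j => by
      rw [hh]
      simp only [coeff_sub, coeff_projNonzero, coeff_toL2_const]
      split_ifs with hj
      · rw [hj, hV0]
        ring
      · ring
  -- The zero mode of the eigenvalue equation, divided by the prescribed mean `-iνε`.
  have hμeq : μ = (ε ^ 2 / ν : ℝ) * inner ℂ u (invHelmholtz ε (u + h)) := by
    have h1 := coeff_eigenvector hν hV 0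
    rw [U.coeff_fn''_zero, U.coeff_zero_opR ε hU, hV0, hW, ← hμ, ← hu, hu0] at h1
    have h2 : (Complex.I * ν * ε) * μ =
        (Complex.I * ν * ε) * ((ε ^ 2 / ν : ℝ) * inner ℂ u (invHelmholtz ε (u + h))) := by
      have h3 : (ν : ℂ) * ((ε ^ 2 / ν : ℝ) : ℂ) = ε ^ 2 := by
        push_cast
        field_simp
      push_cast at h1 h3 ⊢
      linear_combination -h1 - Complex.I * ε * inner ℂ u (invHelmholtz ε (u + h)) * h3
    exact mul_left_cancel₀ (by simp [hν', hε']) h2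
  set x := ‖h‖ with hx
  have hx0 : 0 ≤ x := norm_nonneg _
  set t := ε / ν with ht
  have ht0 : 0 < t := by positivity
  have hinner : ∀ f, ‖(inner ℂ u (invHelmholtz ε f) : ℂ)‖ ≤ K * ((1 + ε ^ 2)⁻¹ * ‖f‖) :=
    norm_inner_invHelmholtz_le hK ε
  clear_value t x u
  have htK : 128 * (t * K) ≤ 1 := by
    have e : 128 * (t * K) = 128 * (ε * K) / ν := by rw [ht]; ring
    rw [e]
    exact (div_le_one hν).2 hεK
  have hμn : ‖μ‖ ≤ ε ^ 2 / ν * (K * (K + x)) := by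
    rw [hμeq, norm_mul, Complex.norm_real, Real.norm_of_nonneg (by positivity)]
    gcongr
    refine (hinner _).trans ?_
    have h1 : ‖u + h‖ ≤ K + x := (norm_add_le _ _).trans (by linarith)
    have h2 : (1 + ε ^ 2)⁻¹ ≤ 1 := inv_le_one_of_one_le₀ (by nlinarith [sq_nonneg ε])
    gcongr
    calc (1 + ε ^ 2)⁻¹ * ‖u + h‖ ≤ 1 * (K + x) := by gcongr
      _ = K + x := one_mul _
  -- In the nonzero modes, `-(i/ε)(-iνε) U'' = -νU''` has coefficients `ν j² u_j` and cancels the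
  -- same term on the left, leaving this source for `h`.
  have hxF : x ≤ 4 / ν * ‖-(μ + ν * ε ^ 2) • u - (Complex.I * ε) • opR U ε u‖ := by
    rw [hx]
    refine norm_le_of_resolvent_eq hK hν hε (by linarith) hl ?_ fun j hj => ?_
    · rw [hh, coeff_sub, coeff_projNonzero, if_pos rfl, hu0, sub_zero]
    · have h1 := coeff_eigenvector hν hV j
      rw [hV0, hW, map_add, coeff_add, U.coeff_fn'', ← hμ, ← hu, mul_pow, Complex.I_sq] at h1
      have h2 : coeff h j = coeff V j - coeff u j := by
        rw [hh, coeff_sub, coeff_projNonzero, if_neg hj]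
      rw [coeff_sub, coeff_smul, coeff_smul, h2]
      field_simp at h1
      ring_nf at h1 ⊢
      simp only [Complex.I_sq] at h1 ⊢
      linear_combination h1
  have hF : ‖-(μ + ν * ε ^ 2) • u - (Complex.I * ε) • opR U ε u‖ ≤
      (ε ^ 2 / ν * (K * (K + x)) + ν * ε ^ 2) * K + ε * (K * K) := by
    refine (norm_sub_le _ _).trans (add_le_add ?_ ?_)
    · rw [norm_smul, norm_neg]
      gcongr
      refine (norm_add_le _ _).trans (add_le_add hμn ?_)
      rw [norm_mul, norm_pow, Complex.norm_real, Complex.norm_real, Real.norm_of_nonneg hν.le,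
        Real.norm_of_nonneg hε.le]
    · rw [norm_smul, norm_mul, Complex.norm_I, one_mul, Complex.norm_real,
        Real.norm_of_nonneg hε.le]
      gcongr
      exact (norm_opR_le hK ε u).trans (by gcongr)
  have hx1 : x ≤ 4 * (t ^ 2 * K ^ 2 * (K + x) + ε ^ 2 * K + t * K ^ 2) := by
    refine (hxF.trans (mul_le_mul_of_nonneg_left hF (by positivity))).trans_eq ?_
    rw [ht]
    field_simp
  have hx2 : x ≤ 16 * K ^ 3 * (t * (1 + ε * ν)) := by
    have e : t * (1 + ε * ν) = t + ε ^ 2 := by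
      rw [ht]
      field_simp
    rw [e]
    exact le_of_bootstrap hx0 ht0 hK1 htK hx1
  refine ⟨by rwa [hVh, ← hx], ?_⟩
  -- The error in the eigenvalue has two sources: replacing `(-∂_yy + ε²)⁻¹` by `(-∂_yy)⁻¹`, and the
  -- corrector `h`.
  have hl' : l - ((ε ^ 2 / ν * (‖invDy u‖ ^ 2 - ν ^ 2) : ℝ) : ℂ) =
      (ε ^ 2 / ν : ℝ) * (inner ℂ u (invHelmholtz ε u - invHelmholtz 0 u) +
        inner ℂ u (invHelmholtz ε h)) := by
    have e1 : l = μ - ν * ε ^ 2 := by rw [hμ]; ring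
    have e2 : ((ε ^ 2 / ν * (‖invDy u‖ ^ 2 - ν ^ 2) : ℝ) : ℂ) =
        (ε ^ 2 / ν : ℝ) * inner ℂ u (invHelmholtz 0 u) - ν * ε ^ 2 := by
      rw [← norm_sq_invDy]
      push_cast
      field_simp
    rw [e1, e2, hμeq, map_add, inner_add_right, inner_sub_right]
    ring
  rw [hl', norm_mul, Complex.norm_real, Real.norm_of_nonneg (by positivity)]
  gcongr
  have hpos : (0 : ℝ) < 1 + ε ^ 2 := by positivity
  -- Only `ε/ν` is small and `ε` may be large, so errors of order `ε²` must keep their weight `(1 +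
  -- ε²)⁻¹` to be bounded by `ε`.
  have hεs : ε ^ 2 / (1 + ε ^ 2) ≤ ε := by
    rw [div_le_iff₀ hpos]
    nlinarith [sq_nonneg (ε - 1), mul_pos hε hε]
  have hνs : 2 ≤ ν + ν⁻¹ := by
    have : 0 ≤ ν⁻¹ * (ν - 1) ^ 2 := by positivity
    have e : ν⁻¹ * (ν - 1) ^ 2 = ν + ν⁻¹ - 2 := by
      field_simp
      ring
    linarith
  have b1 : ‖(inner ℂ u (invHelmholtz ε u - invHelmholtz 0 u) : ℂ)‖ ≤ K ^ 2 * ε := by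
    refine (norm_inner_le_norm _ _).trans ?_
    calc _ ≤ K * (ε * K) := by
          gcongr
          exact (norm_invHelmholtz_sub_le ε u).trans (by gcongr)
      _ = _ := by ring
  have b2 : ‖(inner ℂ u (invHelmholtz ε h) : ℂ)‖ ≤ 16 * K ^ 4 * (t + ε) := by
    refine (hinner h).trans ?_
    rw [← hx]
    calc K * ((1 + ε ^ 2)⁻¹ * x) ≤ K * ((1 + ε ^ 2)⁻¹ * (16 * K ^ 3 * (t * (1 + ε * ν)))) := by
          gcongr
      _ = 16 * K ^ 4 * ((1 + ε ^ 2)⁻¹ * t + ε ^ 2 / (1 + ε ^ 2)) := by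
          rw [ht]
          field_simp
      _ ≤ 16 * K ^ 4 * (1 * t + ε) := by
          gcongr
          exact inv_le_one_of_one_le₀ (by nlinarith [sq_nonneg ε])
      _ = _ := by rw [one_mul]
  refine (norm_add_le _ _).trans ((add_le_add b1 b2).trans ?_)
  have c1 : t ≤ ε * (ν + ν⁻¹) := by
    have : t = ε * ν⁻¹ := ht
    rw [this]
    gcongr
    linarith
  have c2 : ε ≤ ε * (ν + ν⁻¹) := by nlinarith
  have c3 : K ^ 2 ≤ K ^ 4 := pow_le_pow_right₀ hK1 (by norm_num)
  have c4 : K ^ 2 * ε ≤ K ^ 4 * (ε * (ν + ν⁻¹)) := by gcongr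
  have c5 : 16 * K ^ 4 * (t + ε) ≤ 16 * K ^ 4 * (ε * (ν + ν⁻¹) + ε * (ν + ν⁻¹)) := by gcongr
  have c6 : 0 ≤ K ^ 4 * (ε * (ν + ν⁻¹)) := by positivity
  linarith

end OrrSommerfeld

/-! ### The main theorem. -/

theorem theorem2p1 :
    ∀ K : ℝ, ∃ δ₀ C : ℝ, 0 < δ₀ ∧ δ₀ < 1 ∧ 1 < C ∧
      ∀ U : OrrSommerfeld.Profile, U.ZeroMean → U.normC2 ≤ K →
      ∀ ν ε : ℝ, 0 < ν → 0 < ε → ε ≤ δ₀ * ν →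
      ∃ lam : ℤ → ℂ,
        OrrSommerfeld.IsSimpleEigenvalue (OrrSommerfeld.opL U ν ε) (lam 0) ∧
        ‖lam 0 - ((ε ^ 2 / ν *
            (‖OrrSommerfeld.invDy (OrrSommerfeld.toL2 U.fn)‖ ^ 2 - ν ^ 2) : ℝ) : ℂ)‖
          ≤ ε ^ 2 / ν * (C * (ε * (ν + ν⁻¹))) ∧
        (∃ V : OrrSommerfeld.L2T,
          OrrSommerfeld.IsEigenvector (OrrSommerfeld.opL U ν ε) (lam 0) V ∧
          ‖V - (OrrSommerfeld.toL2 U.fn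
              - OrrSommerfeld.toL2 (ContinuousMap.const _ (Complex.I * ν * ε)))‖
            ≤ C * (ε / ν) * (1 + ε * ν)) ∧
        OrrSommerfeld.spectrum (OrrSommerfeld.opL U ν ε) = Set.range lam ∧
        (∀ z : ℂ, OrrSommerfeld.algMultiplicity (OrrSommerfeld.opL U ν ε) z
          = Cardinal.mk {j : ℤ // lam j = z}) ∧
        ∀ j : ℤ, ‖lam j + ((ν * ((j : ℝ) ^ 2 + ε ^ 2) : ℝ) : ℂ)‖ ≤ ν / 2 := by
  intro K₀
  set K := max K₀ 1 with hKdef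
  have hK1 : 1 ≤ K := le_max_right _ _
  have hK4 : 1 ≤ K ^ 4 := one_le_pow₀ hK1
  -- This `δ₀` makes `4εK ≤ ν/32`, as the perturbation argument requires. The eigenvalue estimate
  -- needs `K⁴ + 32K⁴ ≤ C`, and the eigenvector estimate `16K³ ≤ C`.
  refine ⟨1 / (128 * K), 64 * K ^ 4, by positivity, ?_, by linarith, ?_⟩
  · rw [div_lt_one (by positivity)]
    linarith
  intro U hU hUK ν ε hν hε hεν
  have hK : U.normC2 ≤ K := hUK.trans (le_max_left _ _)
  have hεK : 128 * (ε * K) ≤ ν := by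
    calc 128 * (ε * K) ≤ 128 * (1 / (128 * K) * ν * K) := by gcongr
      _ = ν := by field_simp
  have hs : (((1 + ε ^ 2) / ε ^ 2 : ℝ) : ℂ) ≠ 0 := by
    have : (1 + ε ^ 2) / ε ^ 2 ≠ 0 := by positivity
    exact_mod_cast this
  have hB := OrrSommerfeld.norm_conj_boundedPart_le hU hK hε rfl
  obtain ⟨lam, h1, h2, h3⟩ := OrrSommerfeld.exists_eigenvalue_family hν
    (OrrSommerfeld.mem_graph_heat hν.ne') (hB.trans (by linarith : _ ≤ ν / 32))
  have hsim := OrrSommerfeld.opL_similar U ε hν.ne' hs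
  rw [← OrrSommerfeld.spectrum_eq_of_similar _ hsim] at h1
  simp only [← OrrSommerfeld.algMultiplicity_eq_of_similar _ hsim] at h2
  have hsimple : OrrSommerfeld.algMultiplicity (OrrSommerfeld.opL U ν ε) (lam 0) = 1 := by
    rw [h2]
    -- Eigenvalues labelled `j ≠ 0` and `0` lie within `ν/4` of centres at distance at least `ν`, so
    -- they cannot coincide.
    have huniq : ∀ j : ℤ, lam j = lam 0 → j = 0 := fun j hj => by
      by_contra hj0
      have a1 := h3 j
      have a2 := h3 0
      rw [hj] at a1
      have a3 := norm_sub_le (lam 0 + ((ν * ((j : ℝ) ^ 2 + ε ^ 2) : ℝ) : ℂ))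
        (lam 0 + ((ν * (((0 : ℤ) : ℝ) ^ 2 + ε ^ 2) : ℝ) : ℂ))
      rw [add_sub_add_left_eq_sub, ← Complex.ofReal_sub, Complex.norm_real, Real.norm_eq_abs] at a3
      have a4 := (le_abs_self _).trans a3
      have a5 := mul_le_mul_of_nonneg_left (OrrSommerfeld.one_le_sq_of_ne_zero hj0) hν.le
      have a6 : ν * ((j : ℝ) ^ 2 + ε ^ 2) - ν * (((0 : ℤ) : ℝ) ^ 2 + ε ^ 2) = ν * (j : ℝ) ^ 2 := by
        push_cast
        ring
      have a7 := a4.trans (add_le_add a1 a2)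
      rw [a6] at a7
      linarith
    have : Unique {j : ℤ // lam j = lam 0} :=
      { default := ⟨0, rfl⟩, uniq := fun j => Subtype.ext (huniq j j.2) }
    exact Cardinal.mk_eq_one _
  have hl0 : ‖lam 0 + ν * ε ^ 2‖ ≤ ν / 2 := by
    have := h3 0
    push_cast at this
    rw [zero_pow two_ne_zero, zero_add] at this
    linarith
  obtain ⟨V₀, hV₀⟩ := OrrSommerfeld.exists_isEigenvector_of_algMultiplicity_ne_zero
    (hsimple.trans_ne one_ne_zero)
  obtain ⟨V, hV, hV0⟩ := OrrSommerfeld.exists_normalized_eigenvector hK hν hε (by linarith) hl0 hV₀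
  obtain ⟨e1, e2⟩ := OrrSommerfeld.eigenpair_estimates hU hK1 hK hν hε hεK hl0
    (OrrSommerfeld.isEigenvector_iff.1 hV).2 hV0
  refine ⟨lam, hsimple, e2, ⟨V, hV, e1.trans ?_⟩, h1, h2, fun j => (h3 j).trans (by linarith)⟩
  have hK34 : K ^ 3 ≤ K ^ 4 := pow_le_pow_right₀ hK1 (by norm_num)
  have hpos : 0 ≤ ε / ν * (1 + ε * ν) := by positivity
  have := mul_le_mul_of_nonneg_right (by linarith : 16 * K ^ 3 ≤ 64 * K ^ 4) hpos
  rwa [← mul_assoc (64 * K ^ 4)] at this
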